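/- Let $d\ge 0$, $p^{(1)},\dots,p^{(d)}\ge 0$ be integers and $p=p^{(1)}+\dots+p^{(d)}$. Let $Z=\mathrm{Diag}(Z^{(1)},\dots,Z^{(d)})\in\mathbb R^{d\times p}$ and $T=\mathrm{Diag}(T^{(1)},\dots,T^{(d)})\in\mathbb R^{p\times p}$ be block diagonal with blocks $Z^{(j)}\in\mathbb R^{1\times p^{(j)}}$ and $T^{(j)}\in\mathbb R^{p^{(j)}\times p^{(j)}}$. Consider the time-invariant SUTSE (seemingly unrelated time series equations) model $$y_t=Z\alpha_t+\varepsilon_t,\qquad \alpha_{t+1}=T\alpha_t+\eta_t\qquad(t=1,2,\dots),$$ where $\varepsilon_t\sim N(0,\Sigma_\varepsilon)$, $\eta_t\sim N(0,\Sigma_\eta)$, $\alpha_1\sim N(a_1,P_1)$, and where $\varepsilon_t,\varepsilon_k$ are uncorrelated and $\eta_t,\eta_k$ are uncorrelated for $t\ne k$, and $\varepsilon_t,\eta_k$ are uncorrelated for all $t,k$. Let $\Sigma'_\varepsilon$ be the diagonal part of $\Sigma_\varepsilon$, and let $\Sigma'_\eta=\mathrm{Diag}(\Sigma_\eta^{(1)},\dots,\Sigma_\eta^{(d)})$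 be the block-diagonal part of $\Sigma_\eta$, with $\Sigma_\eta^{(j)}$ its $j$-th diagonal block, of size $p^{(j)}\times p^{(j)}$. Run the Kalman filter with these misspecified covariances, from an arbitrary $a_1'\in\mathbb R^p$ and an arbitrary block-diagonal $P_1'=\mathrm{Diag}(P_1'^{(1)},\dots,P_1'^{(d)})$ with positive semidefinite blocks of sizes $p^{(j)}\times p^{(j)}$: for $t\ge1$, $$v_t'=y_t-Za_t',\quad F_t'=ZP_t'Z^{\mathsf T}+\Sigma'_\varepsilon,\quad K_t'=P_t'Z^{\mathsf T}F_t'^{-1},\quad L_t'=I_p-K_t'Z,$$ $$a_{t+1}'=Ta_t'+TK_t'v_t',\qquad P_{t+1}'=TP_t'L_t'^{\mathsf T}T^{\mathsf T}+\Sigma'_\eta .$$ Assume: 1. $\Sigma_\varepsilon$ and $\Sigma_\varepsilon'$ are positive definite; 2. (observability) the matrix obtained by stacking $Z,ZT,\dots,ZT^{p-1}$ has rank $p$; 3. (controllability) $\Sigma_\eta=RQR^{\mathsf T}$ with $R\in\mathbb R^{p\times r}$, $Q\in\mathbb R^{r\times r}$ positive definite and $\mathrm{rank}(R,TR,\dots,T^{p-1}R)=p$;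 likewise $\Sigma'_\eta=R'Q'R'^{\mathsf T}$ with $R'\in\mathbb R^{p\times r'}$, $Q'\in\mathbb R^{r'\times r'}$ positive definite and $\mathrm{rank}(R',TR',\dots,T^{p-1}R')=p$; 4. there is $M>0$ such that $\|(TL'_{t-k})(TL'_{t-k-1})\cdots(TL'_{t-l})\|_F\le M$ (Frobenius norm) for all integers $0\le k\le l\le t-1$. Then, as $t\to\infty$, the mean of the misspecified one-step-ahead forecast error tends to zero, $E(v_t')\to0$, and its covariance matrix converges: there is a matrix $V_{v'}\in\mathbb R^{d\times d}$ with $V(v_t')\to V_{v'}$. (In particular every $v_t'$ has finite second moments.) -/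

import Mathlib

open MeasureTheory ProbabilityTheory Filter Topology Matrix

noncomputable section

/-! Time is indexed by `t = 0, 1, 2, …`; index `t` stands for the `(t+1)`-st time point, so that
the initial quantities (usually written with subscript `1`) are those at `t = 0`. -/

/-- Index set of the stacked state vector `(α^(1)ᵀ, …, α^(d)ᵀ)ᵀ`, where `α^(j)` has dimension
`p j`; its cardinality is `∑ j, p j`. -/
abbrev StateIdx {d : ℕ} (p : Fin d → ℕ) : Type := Σ j : Fin d, Fin (p j)

/-- `Z = Diag(Z^(1), …, Z^(d))`, a `d × p` matrix, with `1 × p^(j)` blocks `Z^(j)`. -/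
def designMatrix {d : ℕ} {p : Fin d → ℕ} (Zc : ∀ j, Matrix (Fin 1) (Fin (p j)) ℝ) :
    Matrix (Fin d) (StateIdx p) ℝ :=
  Matrix.of fun i s => if i = s.1 then Zc s.1 0 s.2 else 0

/-- `T = Diag(T^(1), …, T^(d))`, a `p × p` matrix, with `p^(j) × p^(j)` blocks `T^(j)`. -/
def transitionMatrix {d : ℕ} {p : Fin d → ℕ} (Tc : ∀ j, Matrix (Fin (p j)) (Fin (p j)) ℝ) :
    Matrix (StateIdx p) (StateIdx p) ℝ :=
  Matrix.blockDiagonal' Tc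

/-- The misspecified observation noise covariance `Σ_ε' = Diag(Σ_ε(1,1), …, Σ_ε(d,d))`. -/
def misspecObsCov {d : ℕ} (Sε : Matrix (Fin d) (Fin d) ℝ) : Matrix (Fin d) (Fin d) ℝ :=
  Matrix.diagonal Sε.diag

/-- The misspecified state noise covariance `Σ_η' = Diag(Σ_η^(1), …, Σ_η^(d))`, where `Σ_η^(j)` is
the `j`-th diagonal block of `Σ_η`, i.e. the covariance matrix of `η^(j)`. -/
def misspecStateCov {d : ℕ} {p : Fin d → ℕ} (Sη : Matrix (StateIdx p) (StateIdx p) ℝ) :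
    Matrix (StateIdx p) (StateIdx p) ℝ :=
  Matrix.blockDiagonal' (Matrix.blockDiag' Sη)

/-- `X` has the (possibly degenerate) multivariate normal law `N(m, S)`. -/
def IsNormal {Ω : Type*} [MeasurableSpace Ω] {ι : Type*} [Fintype ι] [DecidableEq ι]
    (X : Ω → ι → ℝ) (m : ι → ℝ) (S : Matrix ι ι ℝ) (μ : Measure Ω) : Prop :=
  S.PosSemidef ∧
    HasLaw (fun ω => WithLp.toLp 2 (X ω)) (multivariateGaussian (WithLp.toLp 2 m) S) μ

/-- The random vectors `X` and `Y` are uncorrelated: all cross-covariances vanish. -/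
def Uncorrelated {Ω : Type*} [MeasurableSpace Ω] {ι κ : Type*}
    (X : Ω → ι → ℝ) (Y : Ω → κ → ℝ) (μ : Measure Ω) : Prop :=
  ∀ i j, cov[fun ω => X ω i, fun ω => Y ω j; μ] = 0

/-- The linear Gaussian state-space model with time-invariant `Z` and `T`: observations `y`,
states `α`, observation noise `ε`, state noise `η`. -/
structure IsStateSpaceModel {Ω : Type*} [MeasurableSpace Ω] {m n : Type*}
    [Fintype m] [DecidableEq m] [Fintype n] [DecidableEq n]
    (μ : Measure Ω) (Z : Matrix m n ℝ) (T : Matrix n n ℝ)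
    (Sε : Matrix m m ℝ) (Sη : Matrix n n ℝ) (a₁ : n → ℝ) (P₁ : Matrix n n ℝ)
    (y : ℕ → Ω → m → ℝ) (α : ℕ → Ω → n → ℝ) (ε : ℕ → Ω → m → ℝ) (η : ℕ → Ω → n → ℝ) :
    Prop where
  observation : ∀ t ω, y t ω = Z *ᵥ α t ω + ε t ω
  transition : ∀ t ω, α (t + 1) ω = T *ᵥ α t ω + η t ω
  obs_noise : ∀ t, IsNormal (ε t) 0 Sε μ
  state_noise : ∀ t, IsNormal (η t) 0 Sη μ
  initial : IsNormal (α 0) a₁ P₁ μ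
  uncorr_obs : ∀ t k, t ≠ k → Uncorrelated (ε t) (ε k) μ
  uncorr_state : ∀ t k, t ≠ k → Uncorrelated (η t) (η k) μ
  uncorr_obs_state : ∀ t k, Uncorrelated (ε t) (η k) μ

section KalmanFilter

variable {m n : Type*} [Fintype m] [DecidableEq m] [Fintype n] [DecidableEq n]

/-- `F = Z P Zᵀ + Σ_ε`. -/
def kalmanF (Z : Matrix m n ℝ) (Sε : Matrix m m ℝ) (P : Matrix n n ℝ) : Matrix m m ℝ :=
  Z * P * Zᵀ + Sε

/-- `K = P Zᵀ F⁻¹`. -/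
def kalmanK (Z : Matrix m n ℝ) (Sε : Matrix m m ℝ) (P : Matrix n n ℝ) : Matrix n m ℝ :=
  P * Zᵀ * (kalmanF Z Sε P)⁻¹

/-- `L = I - K Z`. -/
def kalmanL (Z : Matrix m n ℝ) (Sε : Matrix m m ℝ) (P : Matrix n n ℝ) : Matrix n n ℝ :=
  1 - kalmanK Z Sε P * Z

/-- `P_{t+1} = T P_t L_tᵀ Tᵀ + Σ_η`, started at `P₁`. -/
def kalmanP (Z : Matrix m n ℝ) (T : Matrix n n ℝ) (Sε : Matrix m m ℝ) (Sη : Matrix n n ℝ)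
    (P₁ : Matrix n n ℝ) : ℕ → Matrix n n ℝ
  | 0 => P₁
  | t + 1 =>
      T * kalmanP Z T Sε Sη P₁ t * (kalmanL Z Sε (kalmanP Z T Sε Sη P₁ t))ᵀ * Tᵀ + Sη

/-- `a_{t+1} = T a_t + T K_t v_t` with `v_t = y_t - Z a_t`, started at `a₁`, for a path `y` of
observations. -/
def kalmanA (Z : Matrix m n ℝ) (T : Matrix n n ℝ) (Sε : Matrix m m ℝ) (Sη : Matrix n n ℝ)
    (a₁ : n → ℝ) (P₁ : Matrix n n ℝ) (y : ℕ → m → ℝ) : ℕ → n → ℝ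
  | 0 => a₁
  | t + 1 =>
      T *ᵥ kalmanA Z T Sε Sη a₁ P₁ y t +
        (T * kalmanK Z Sε (kalmanP Z T Sε Sη P₁ t)) *ᵥ
          (y t - Z *ᵥ kalmanA Z T Sε Sη a₁ P₁ y t)

/-- One-step-ahead forecast error `v_t = y_t - Z a_t`. -/
def kalmanV (Z : Matrix m n ℝ) (T : Matrix n n ℝ) (Sε : Matrix m m ℝ) (Sη : Matrix n n ℝ)
    (a₁ : n → ℝ) (P₁ : Matrix n n ℝ) (y : ℕ → m → ℝ) (t : ℕ) : m → ℝ :=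
  y t - Z *ᵥ kalmanA Z T Sε Sη a₁ P₁ y t

end KalmanFilter

/-- The forecast error `v_t'` of the filter run with the misspecified `Σ_ε'`, `Σ_η'` and with
initial values `a₁'` and `P₁' = Diag(P₁'^(1), …, P₁'^(d))`. -/
def misspecError {Ω : Type*} {d : ℕ} {p : Fin d → ℕ}
    (Zc : ∀ j, Matrix (Fin 1) (Fin (p j)) ℝ) (Tc : ∀ j, Matrix (Fin (p j)) (Fin (p j)) ℝ)
    (Sε : Matrix (Fin d) (Fin d) ℝ) (Sη : Matrix (StateIdx p) (StateIdx p) ℝ)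
    (a₁' : StateIdx p → ℝ) (P₁' : ∀ j, Matrix (Fin (p j)) (Fin (p j)) ℝ)
    (y : ℕ → Ω → Fin d → ℝ) (t : ℕ) (ω : Ω) : Fin d → ℝ :=
  kalmanV (designMatrix Zc) (transitionMatrix Tc) (misspecObsCov Sε) (misspecStateCov Sη)
    a₁' (Matrix.blockDiagonal' P₁') (fun s => y s ω) t

/-- The matrix `T L_t'` of the misspecified filter. -/
def misspecTL {d : ℕ} {p : Fin d → ℕ}
    (Zc : ∀ j, Matrix (Fin 1) (Fin (p j)) ℝ) (Tc : ∀ j, Matrix (Fin (p j)) (Fin (p j)) ℝ)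
    (Sε : Matrix (Fin d) (Fin d) ℝ) (Sη : Matrix (StateIdx p) (StateIdx p) ℝ)
    (P₁' : ∀ j, Matrix (Fin (p j)) (Fin (p j)) ℝ) (t : ℕ) :
    Matrix (StateIdx p) (StateIdx p) ℝ :=
  transitionMatrix Tc *
    kalmanL (designMatrix Zc) (misspecObsCov Sε)
      (kalmanP (designMatrix Zc) (transitionMatrix Tc) (misspecObsCov Sε) (misspecStateCov Sη)
        (Matrix.blockDiagonal' P₁') t)

/-- Observability: the stacked matrix `(Zᵀ, (ZT)ᵀ, …, (ZT^{p-1})ᵀ)ᵀ` has rank `p`. -/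
def IsObservable {m n : Type*} [Fintype n] [DecidableEq n]
    (Z : Matrix m n ℝ) (T : Matrix n n ℝ) : Prop :=
  (Matrix.of fun (ki : Fin (Fintype.card n) × m) (j : n) =>
    (Z * T ^ (ki.1 : ℕ)) ki.2 j).rank = Fintype.card n

/-- Controllability of `T` with noise covariance `S`: `S = R Q Rᵀ` with `R` of size `p × r`, `Q`
positive definite of size `r × r`, and `(R, TR, …, T^{p-1}R)` of rank `p`. -/
def IsControllable {n : Type*} [Fintype n] [DecidableEq n]
    (T : Matrix n n ℝ) (S : Matrix n n ℝ) : Prop :=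
  ∃ (r : ℕ) (R : Matrix n (Fin r) ℝ) (Q : Matrix (Fin r) (Fin r) ℝ),
    Q.PosDef ∧ S = R * Q * Rᵀ ∧
    (Matrix.of fun (i : n) (kj : Fin (Fintype.card n) × Fin r) =>
      (T ^ (kj.1 : ℕ) * R) i kj.2).rank = Fintype.card n

/-- Frobenius norm. -/
def frobNorm {m n : Type*} [Fintype m] [Fintype n] (A : Matrix m n ℝ) : ℝ :=
  Real.sqrt (∑ i, ∑ j, A i j ^ 2)

/-- The ordered product `∏_{i=k}^{l} A_{t-i} = A_{t-k} A_{t-k-1} ⋯ A_{t-l}`. -/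
def backProd {n : Type*} [Fintype n] [DecidableEq n] (A : ℕ → Matrix n n ℝ) (t k l : ℕ) :
    Matrix n n ℝ :=
  ((List.range' k (l + 1 - k)).map fun i => A (t - i)).prod

/-- The standing assumptions: (1) nondegenerate observation noise, (2) observability,
(3) controllability for both `Σ_η` and `Σ_η'`, (4) bounded products of the matrices `T L_t'`. -/
structure FilterAssumption {d : ℕ} {p : Fin d → ℕ}
    (Zc : ∀ j, Matrix (Fin 1) (Fin (p j)) ℝ) (Tc : ∀ j, Matrix (Fin (p j)) (Fin (p j)) ℝ)
    (Sε : Matrix (Fin d) (Fin d) ℝ) (Sη : Matrix (StateIdx p) (StateIdx p) ℝ)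
    (P₁' : ∀ j, Matrix (Fin (p j)) (Fin (p j)) ℝ) : Prop where
  obsCov_pos : Sε.PosDef
  obsCov'_pos : (misspecObsCov Sε).PosDef
  observable : IsObservable (designMatrix Zc) (transitionMatrix Tc)
  controllable : IsControllable (transitionMatrix Tc) Sη
  controllable' : IsControllable (transitionMatrix Tc) (misspecStateCov Sη)
  bounded : ∃ M : ℝ, 0 < M ∧ ∀ k l t : ℕ, k ≤ l → l ≤ t →
    frobNorm (backProd (misspecTL Zc Tc Sε Sη P₁') t k l) ≤ M

/-- The mean vector of a random vector. -/
def meanVec {Ω : Type*} [MeasurableSpace Ω] {ι : Type*} (μ : Measure Ω) (X : Ω → ι → ℝ) :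
    ι → ℝ :=
  fun i => ∫ ω, X ω i ∂μ

/-- The covariance matrix of a random vector. -/
def covMat {Ω : Type*} [MeasurableSpace Ω] {ι : Type*} (μ : Measure Ω) (X : Ω → ι → ℝ) :
    Matrix ι ι ℝ :=
  Matrix.of fun i j => cov[fun ω => X ω i, fun ω => X ω j; μ]

end

/-!
Let `x_t = α_t - a_t'` be the state prediction error of the misspecified filter. With
`A_t = T L_t'` and `G_t = T K_t'` it satisfies the linear recursion
`x_{t+1} = A_t x_t + (η_t - G_t ε_t)`, and `v_t' = Z x_t + ε_t`. The coefficients depend on the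
misspecified covariances only, the noise on the true ones. So it suffices that `P_t'` converges and
that the limit `A` of `A_t` is stable (`A ^ t → 0`); the moments of `x_t` then solve stable linear
recursions with convergent coefficients.

*Convergence of the Riccati recursion* (`riccati_convergence`). By completion of squares
(`riccatiMap_completion_of_squares`), `x ⬝ᵥ P_N *ᵥ x` is the minimal cost of steering the dual
system `s ↦ Tᵀ s + Zᵀ u` from `s = x` over `N` steps, with running cost `s ⬝ᵥ Q s + u ⬝ᵥ R u` and
terminal cost `s ⬝ᵥ P_0 s`. For `P_0 = 0` the minimum increases with `N`, and it is bounded because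
observability of `(Z, T)` allows steering to zero in finitely many steps; hence it converges to a
fixed point `S`. Along the closed loop of `S` the value function drops by the running cost, so the
running cost tends to zero and, by controllability of `(T, Q)`, so does the state: the closed loop
`(T L)ᵀ` is stable. For a general `P_0`, the iterate lies between the one started at zero and the
cost of this closed loop, and both tend to `S`.

*Moments.* A linear recursion whose coefficients tend to a stable matrix is treated with a Lyapunov
function of the limit (`tendsto_zero_of_asymptotically_stable`). This gives the mean at once, and
the covariance after vectorization (`exists_tendsto_of_lyapunov_recursion`). The initial state is
not assumed uncorrelated with the noise, so `x_t` may be correlated with `ε_t` and `η_t`; that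
correlation is inherited from `x_0` alone, and it is forgotten because variances are constant and
the products of the `A_t` tend to zero (`tendsto_crossCov_zero_of_recursion`).
-/

set_option linter.unusedSectionVars false

/-! ### Quadratic forms and limits of matrices -/

theorem Matrix.dotProduct_mulVec_eq_transpose {k l : Type*} [Fintype k] [Fintype l]
    (M : Matrix k l ℝ) (x : k → ℝ) (y : l → ℝ) : x ⬝ᵥ M *ᵥ y = y ⬝ᵥ Mᵀ *ᵥ x := by
  rw [dotProduct_mulVec, mulVec_transpose, dotProduct_comm]

theorem Matrix.PosSemidef.quadForm_nonneg {k : Type*} [Fintype k] {M : Matrix k k ℝ}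
    (hM : M.PosSemidef) (x : k → ℝ) : 0 ≤ x ⬝ᵥ M *ᵥ x := by
  simpa using hM.dotProduct_mulVec_nonneg x

theorem Matrix.PosSemidef.transpose_eq {k : Type*} [Fintype k] {M : Matrix k k ℝ}
    (hM : M.PosSemidef) : Mᵀ = M := by
  simpa [conjTranspose_eq_transpose_of_trivial] using hM.isHermitian.eq

theorem Matrix.exists_mul_eq_one_of_rank_eq_card {k n : Type*} [Fintype k] [Fintype n]
    [DecidableEq n] {M : Matrix k n ℝ} (hM : M.rank = Fintype.card n) :
    ∃ G : Matrix n k ℝ, G * M = 1 := by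
  classical
  have hker : LinearMap.ker M.mulVecLin = ⊥ := by
    have h := M.mulVecLin.finrank_range_add_finrank_ker
    rw [← Matrix.rank, hM, Module.finrank_fintype_fun_eq_card] at h
    exact Submodule.finrank_eq_zero.1 (by omega)
  obtain ⟨g, hg⟩ := M.mulVecLin.exists_leftInverse_of_injective hker
  refine ⟨LinearMap.toMatrix' g, ?_⟩
  have : M = LinearMap.toMatrix' M.mulVecLin := (LinearMap.toMatrix'_toLin' M).symm
  rw [this, ← LinearMap.toMatrix'_comp, hg, LinearMap.toMatrix'_id]

open scoped MatrixOrder in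
theorem Matrix.PosSemidef.exists_eq_transpose_mul_self {k : Type*} [Fintype k] {M : Matrix k k ℝ}
    (hM : M.PosSemidef) : ∃ B : Matrix k k ℝ, M = Bᵀ * B := by
  classical
  obtain ⟨B, hB⟩ := CStarAlgebra.nonneg_iff_eq_star_mul_self.mp hM.nonneg
  exact ⟨B, by rw [hB, star_eq_conjTranspose, conjTranspose_eq_transpose_of_trivial]⟩

theorem Matrix.PosDef.tendsto_zero_of_quadForm {ι k : Type*} [Fintype k] [DecidableEq k]
    {l : Filter ι} {M : Matrix k k ℝ} (hM : M.PosDef) {x : ι → k → ℝ}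
    (h : Tendsto (fun i => x i ⬝ᵥ M *ᵥ x i) l (𝓝 0)) : Tendsto x l (𝓝 0) := by
  classical
  obtain ⟨B, hB⟩ := hM.posSemidef.exists_eq_transpose_mul_self
  have hq : ∀ y, y ⬝ᵥ M *ᵥ y = ∑ j, (B *ᵥ y) j ^ 2 := fun y => by
    rw [hB, ← mulVec_mulVec, dotProduct_mulVec, vecMul_transpose]
    simp [dotProduct, sq]
  have hBx : Tendsto (fun i => B *ᵥ x i) l (𝓝 0) := by
    refine tendsto_pi_nhds.2 fun j => ?_
    have h2 : Tendsto (fun i => (B *ᵥ x i) j ^ 2) l (𝓝 0) := by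
      refine squeeze_zero (fun i => sq_nonneg _) (fun i => ?_) h
      rw [hq]
      exact Finset.single_le_sum (f := fun j => (B *ᵥ x i) j ^ 2) (fun _ _ => sq_nonneg _)
        (Finset.mem_univ j)
    have h3 := (Real.continuous_sqrt.tendsto 0).comp h2
    simp only [Function.comp_def, Real.sqrt_sq_eq_abs, Real.sqrt_zero] at h3
    exact (tendsto_zero_iff_abs_tendsto_zero _).2 h3
  have hinv : M⁻¹ * Bᵀ * B = 1 := by
    rw [Matrix.mul_assoc, ← hB]
    exact nonsing_inv_mul _ ((isUnit_iff_isUnit_det _).1 hM.isUnit)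
  have := ((continuous_const.matrix_mulVec continuous_id :
    Continuous fun y => (M⁻¹ * Bᵀ) *ᵥ y).tendsto 0).comp hBx
  simpa [Function.comp_def, mulVec_mulVec, hinv] using this

/-- Polarization: pointwise convergence of quadratic forms gives convergence of the symmetric
matrices. -/
theorem Matrix.tendsto_of_tendsto_quadForm {ι k : Type*} [Fintype k] [DecidableEq k]
    {l : Filter ι} {P : ι → Matrix k k ℝ} (hsymm : ∀ i, (P i)ᵀ = P i) {q : (k → ℝ) → ℝ}
    (h : ∀ x, Tendsto (fun i => x ⬝ᵥ P i *ᵥ x) l (𝓝 (q x))) :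
    Tendsto P l (𝓝 (of fun a b =>
      (q (Pi.single a 1 + Pi.single b 1) - q (Pi.single a 1) - q (Pi.single b 1)) / 2)) := by
  refine tendsto_pi_nhds.2 fun a => tendsto_pi_nhds.2 fun b => ?_
  refine ((((h (Pi.single a 1 + Pi.single b 1)).sub (h (Pi.single a 1))).sub
    (h (Pi.single b 1))).div_const 2).congr fun i => ?_
  have : P i b a = P i a b := congrFun (congrFun (hsymm i) a) b
  simp [mulVec_add, add_dotProduct, dotProduct_add, this]
  ring

theorem Matrix.posSemidef_of_tendsto {k ι : Type*} [Fintype k] {l : Filter ι} [l.NeBot]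
    {S : ι → Matrix k k ℝ} {S' : Matrix k k ℝ} (hS : ∀ i, (S i).PosSemidef)
    (h : Tendsto S l (𝓝 S')) : S'.PosSemidef := by
  refine PosSemidef.of_dotProduct_mulVec_nonneg ?_ fun x => ?_
  · rw [IsHermitian, conjTranspose_eq_transpose_of_trivial]
    refine tendsto_nhds_unique (((continuous_id.matrix_transpose).tendsto S').comp h) ?_
    simpa [Function.comp_def, fun i => (hS i).transpose_eq] using h
  · have hc : Continuous fun M : Matrix k k ℝ => x ⬝ᵥ M *ᵥ x := by fun_prop
    rw [star_trivial]
    exact ge_of_tendsto ((hc.tendsto S').comp h) (Eventually.of_forall fun i =>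
      (hS i).quadForm_nonneg x)

theorem Matrix.tendsto_zero_of_transpose_mulVec {ι k : Type*} [Fintype k] [DecidableEq k]
    {l : Filter ι} {M : ι → Matrix k k ℝ} (h : ∀ x, Tendsto (fun i => (M i)ᵀ *ᵥ x) l (𝓝 0)) :
    Tendsto M l (𝓝 0) := by
  refine tendsto_pi_nhds.2 fun a => tendsto_pi_nhds.2 fun b => ?_
  simpa using tendsto_pi_nhds.1 (h (Pi.single a 1)) b

theorem Matrix.continuousAt_inv_of_posDef {m : Type*} [Fintype m] [DecidableEq m]
    {F : Matrix m m ℝ} (hF : F.PosDef) :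
    ContinuousAt Inv.inv F := by
  refine continuousAt_matrix_inv F ?_
  rw [Ring.inverse_eq_inv']
  exact continuousAt_inv₀ ((isUnit_iff_isUnit_det _).1 hF.isUnit).ne_zero

theorem Matrix.PosSemidef.blockDiagonal' {ι : Type*} [Fintype ι] [DecidableEq ι] {κ : ι → Type*}
    [∀ i, Fintype (κ i)] {M : ∀ i, Matrix (κ i) (κ i) ℝ} (hM : ∀ i, (M i).PosSemidef) :
    (Matrix.blockDiagonal' M).PosSemidef := by
  choose B hB using fun i => (hM i).exists_eq_transpose_mul_self
  rw [funext hB, blockDiagonal'_mul, ← blockDiagonal'_transpose,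
    ← conjTranspose_eq_transpose_of_trivial]
  exact posSemidef_conjTranspose_mul_self _

/-! ### The Riccati map and the dual control problem -/

theorem kalmanF_posDef {m n : Type*} [Fintype m] [Fintype n] (Z : Matrix m n ℝ)
    {R : Matrix m m ℝ} {P : Matrix n n ℝ} (hR : R.PosDef) (hP : P.PosSemidef) :
    (kalmanF Z R P).PosDef := by
  have := hP.mul_mul_conjTranspose_same Z
  rw [conjTranspose_eq_transpose_of_trivial] at this
  exact PosDef.posSemidef_add this hR

section RiccatiStep

variable {m n : Type*} [Fintype m] [DecidableEq m] [Fintype n] [DecidableEq n]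

/-- One step `P ↦ T P Lᵀ Tᵀ + Q` of the Riccati recursion of the Kalman filter. -/
noncomputable def riccatiMap (Z : Matrix m n ℝ) (T : Matrix n n ℝ) (R : Matrix m m ℝ)
    (Q P : Matrix n n ℝ) : Matrix n n ℝ :=
  T * P * (kalmanL Z R P)ᵀ * Tᵀ + Q

theorem kalmanP_succ (Z : Matrix m n ℝ) (T : Matrix n n ℝ) (R : Matrix m m ℝ)
    (Q P₀ : Matrix n n ℝ) (t : ℕ) :
    kalmanP Z T R Q P₀ (t + 1) = riccatiMap Z T R Q (kalmanP Z T R Q P₀ t) := rfl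

variable {Z : Matrix m n ℝ} {T : Matrix n n ℝ} {R : Matrix m m ℝ} {Q P : Matrix n n ℝ}

theorem kalmanF_mul_transpose_kalmanK (hR : R.PosDef) (hP : P.PosSemidef) :
    kalmanF Z R P * (kalmanK Z R P)ᵀ = Z * P := by
  have hF := kalmanF_posDef Z hR hP
  have hdet : IsUnit (kalmanF Z R P).det := (isUnit_iff_isUnit_det _).1 hF.isUnit
  rw [kalmanK, transpose_mul, transpose_mul, transpose_transpose, hP.transpose_eq,
    transpose_nonsing_inv, hF.posSemidef.transpose_eq, ← Matrix.mul_assoc,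
    mul_nonsing_inv _ hdet, Matrix.one_mul]

/-- Completion of squares: `x ⬝ᵥ riccatiMap P *ᵥ x` is the minimum over controls `u` of the one-step
cost in the dual linear-quadratic control problem, attained at `u = -(T K)ᵀ x`. -/
theorem riccatiMap_completion_of_squares (hR : R.PosDef) (hP : P.PosSemidef)
    (x : n → ℝ) (u : m → ℝ) :
    (Tᵀ *ᵥ x + Zᵀ *ᵥ u) ⬝ᵥ P *ᵥ (Tᵀ *ᵥ x + Zᵀ *ᵥ u) + (x ⬝ᵥ Q *ᵥ x + u ⬝ᵥ R *ᵥ u) =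
      x ⬝ᵥ riccatiMap Z T R Q P *ᵥ x +
        (u + (T * kalmanK Z R P)ᵀ *ᵥ x) ⬝ᵥ kalmanF Z R P *ᵥ (u + (T * kalmanK Z R P)ᵀ *ᵥ x) := by
  have hFK := kalmanF_mul_transpose_kalmanK (Z := Z) hR hP
  have hFs := (kalmanF_posDef Z hR hP).posSemidef.transpose_eq
  have hPs := hP.transpose_eq
  set F := kalmanF Z R P with hF
  set K := kalmanK Z R P with hK
  have e1 : x ⬝ᵥ riccatiMap Z T R Q P *ᵥ x =
      (Tᵀ *ᵥ x) ⬝ᵥ P *ᵥ (Tᵀ *ᵥ x) - (Tᵀ *ᵥ x) ⬝ᵥ (P * Zᵀ * Kᵀ) *ᵥ (Tᵀ *ᵥ x) + x ⬝ᵥ Q *ᵥ x := by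
    have : riccatiMap Z T R Q P = T * (P * Tᵀ) - T * (P * Zᵀ * Kᵀ * Tᵀ) + Q := by
      rw [riccatiMap, kalmanL, ← hK]
      simp only [transpose_sub, transpose_one, transpose_mul, Matrix.mul_sub, Matrix.sub_mul,
        Matrix.mul_one, Matrix.mul_assoc]
    rw [this, add_mulVec, sub_mulVec, dotProduct_add, dotProduct_sub]
    simp only [← mulVec_mulVec]
    rw [dotProduct_mulVec x T, dotProduct_mulVec x T, ← mulVec_transpose]
  have e2 : (T * K)ᵀ *ᵥ x = Kᵀ *ᵥ (Tᵀ *ᵥ x) := by rw [transpose_mul, mulVec_mulVec]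
  rw [e1, e2]
  set g := Tᵀ *ᵥ x
  have e3 : F *ᵥ (u + Kᵀ *ᵥ g) = F *ᵥ u + (Z * P) *ᵥ g := by
    rw [mulVec_add, mulVec_mulVec, hFK]
  have e4 : (Kᵀ *ᵥ g) ⬝ᵥ F *ᵥ u = u ⬝ᵥ (Z * P) *ᵥ g := by
    rw [dotProduct_mulVec_eq_transpose, hFs, mulVec_mulVec, hFK]
  have e5 : (Kᵀ *ᵥ g) ⬝ᵥ (Z * P) *ᵥ g = g ⬝ᵥ (P * Zᵀ * Kᵀ) *ᵥ g := by
    rw [dotProduct_mulVec_eq_transpose, mulVec_mulVec, transpose_mul, hPs]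
  have e6 : u ⬝ᵥ F *ᵥ u = (Zᵀ *ᵥ u) ⬝ᵥ P *ᵥ (Zᵀ *ᵥ u) + u ⬝ᵥ R *ᵥ u := by
    rw [hF, kalmanF, add_mulVec, dotProduct_add, ← mulVec_mulVec, ← mulVec_mulVec,
      dotProduct_mulVec u Z, ← mulVec_transpose]
  have e7 : u ⬝ᵥ (Z * P) *ᵥ g = (Zᵀ *ᵥ u) ⬝ᵥ P *ᵥ g := by
    rw [← mulVec_mulVec, dotProduct_mulVec u Z, ← mulVec_transpose]
  have e8 : g ⬝ᵥ P *ᵥ (Zᵀ *ᵥ u) = (Zᵀ *ᵥ u) ⬝ᵥ P *ᵥ g := by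
    rw [dotProduct_mulVec_eq_transpose, hPs]
  rw [e3]
  simp only [add_dotProduct, dotProduct_add, mulVec_add, e4, e5, e6, e8, e7]
  ring

theorem transpose_mulVec_sub_gain (x : n → ℝ) :
    (T * kalmanL Z R P)ᵀ *ᵥ x = Tᵀ *ᵥ x + Zᵀ *ᵥ (-((T * kalmanK Z R P)ᵀ *ᵥ x)) := by
  rw [mulVec_neg, mulVec_mulVec, ← transpose_mul, ← sub_eq_add_neg, ← sub_mulVec, ← transpose_sub,
    kalmanL, Matrix.mul_sub, Matrix.mul_one, Matrix.mul_assoc]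

theorem riccatiMap_le_cost (hR : R.PosDef) (hP : P.PosSemidef) (x : n → ℝ) (u : m → ℝ) :
    x ⬝ᵥ riccatiMap Z T R Q P *ᵥ x ≤
      (Tᵀ *ᵥ x + Zᵀ *ᵥ u) ⬝ᵥ P *ᵥ (Tᵀ *ᵥ x + Zᵀ *ᵥ u) + (x ⬝ᵥ Q *ᵥ x + u ⬝ᵥ R *ᵥ u) := by
  rw [riccatiMap_completion_of_squares hR hP]
  linarith [(kalmanF_posDef Z hR hP).posSemidef.quadForm_nonneg (u + (T * kalmanK Z R P)ᵀ *ᵥ x)]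

theorem riccatiMap_eq_optimal_cost (hR : R.PosDef) (hP : P.PosSemidef) (x : n → ℝ) :
    x ⬝ᵥ riccatiMap Z T R Q P *ᵥ x =
      ((T * kalmanL Z R P)ᵀ *ᵥ x) ⬝ᵥ P *ᵥ ((T * kalmanL Z R P)ᵀ *ᵥ x) + (x ⬝ᵥ Q *ᵥ x +
        (-((T * kalmanK Z R P)ᵀ *ᵥ x)) ⬝ᵥ R *ᵥ (-((T * kalmanK Z R P)ᵀ *ᵥ x))) := by
  rw [transpose_mulVec_sub_gain, riccatiMap_completion_of_squares hR hP]
  simp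

theorem riccatiMap_posSemidef (hR : R.PosDef) (hQ : Q.PosSemidef) (hP : P.PosSemidef) :
    (riccatiMap Z T R Q P).PosSemidef := by
  refine PosSemidef.of_dotProduct_mulVec_nonneg ?_ fun x => ?_
  · have hFs := (kalmanF_posDef Z hR hP).posSemidef.transpose_eq
    have : riccatiMap Z T R Q P
        = T * P * Tᵀ - T * P * Zᵀ * (kalmanF Z R P)⁻¹ * Z * P * Tᵀ + Q := by
      rw [riccatiMap, kalmanL, kalmanK]
      simp only [transpose_sub, transpose_one, transpose_mul, transpose_nonsing_inv, hFs,
        hP.transpose_eq, transpose_transpose, Matrix.mul_sub, Matrix.sub_mul, Matrix.mul_one,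
        Matrix.mul_assoc]
    rw [IsHermitian, conjTranspose_eq_transpose_of_trivial, this]
    simp only [transpose_sub, transpose_add, transpose_mul, transpose_nonsing_inv, hFs,
        hP.transpose_eq, hQ.transpose_eq, transpose_transpose, Matrix.mul_assoc]
  · rw [star_trivial, riccatiMap_eq_optimal_cost hR hP]
    have h1 := hP.quadForm_nonneg ((T * kalmanL Z R P)ᵀ *ᵥ x)
    have h2 := hQ.quadForm_nonneg x
    have h3 := hR.posSemidef.quadForm_nonneg (-((T * kalmanK Z R P)ᵀ *ᵥ x))
    linarith

theorem kalmanP_posSemidef (hR : R.PosDef) (hQ : Q.PosSemidef) (hP : P.PosSemidef) (t : ℕ) :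
    (kalmanP Z T R Q P t).PosSemidef := by
  induction t with
  | zero => exact hP
  | succ t ih => exact riccatiMap_posSemidef hR hQ ih

/-- The Riccati map is a minimum over controls of costs increasing in `P`, hence increasing. -/
theorem riccatiMap_mono {P' : Matrix n n ℝ} (hR : R.PosDef) (hP : P.PosSemidef)
    (hP' : P'.PosSemidef) (h : ∀ x, x ⬝ᵥ P *ᵥ x ≤ x ⬝ᵥ P' *ᵥ x) (x : n → ℝ) :
    x ⬝ᵥ riccatiMap Z T R Q P *ᵥ x ≤ x ⬝ᵥ riccatiMap Z T R Q P' *ᵥ x := by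
  rw [riccatiMap_eq_optimal_cost hR hP', transpose_mulVec_sub_gain]
  refine (riccatiMap_le_cost hR hP x (-((T * kalmanK Z R P')ᵀ *ᵥ x))).trans ?_
  gcongr
  exact h _

theorem kalmanP_mono_initial {P' : Matrix n n ℝ} (hR : R.PosDef) (hQ : Q.PosSemidef)
    (hP : P.PosSemidef) (hP' : P'.PosSemidef) (h : ∀ x, x ⬝ᵥ P *ᵥ x ≤ x ⬝ᵥ P' *ᵥ x) (t : ℕ) :
    ∀ x : n → ℝ, x ⬝ᵥ kalmanP Z T R Q P t *ᵥ x ≤ x ⬝ᵥ kalmanP Z T R Q P' t *ᵥ x := by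
  induction t with
  | zero => exact h
  | succ t ih =>
    exact riccatiMap_mono hR (kalmanP_posSemidef hR hQ hP t) (kalmanP_posSemidef hR hQ hP' t) ih

theorem kalmanP_zero_monotone (hR : R.PosDef) (hQ : Q.PosSemidef) (x : n → ℝ) :
    Monotone fun t => x ⬝ᵥ kalmanP Z T R Q 0 t *ᵥ x := by
  refine monotone_nat_of_le_succ fun t => ?_
  induction t generalizing x with
  | zero =>
    simpa [kalmanP] using
      (kalmanP_posSemidef (Z := Z) (T := T) hR hQ PosSemidef.zero 1).quadForm_nonneg x
  | succ t ih =>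
    exact riccatiMap_mono hR (kalmanP_posSemidef hR hQ PosSemidef.zero t)
      (kalmanP_posSemidef hR hQ PosSemidef.zero (t + 1)) ih x

/-- The cost of any controlled trajectory of the dual system `s ↦ Tᵀ s + Zᵀ u` bounds the
quadratic form of the Riccati iterate from above. -/
theorem kalmanP_le_trajectory_cost (hR : R.PosDef) (hQ : Q.PosSemidef) (hP : P.PosSemidef) (N : ℕ)
    (s : ℕ → n → ℝ) (u : ℕ → m → ℝ) (hs : ∀ i, s (i + 1) = Tᵀ *ᵥ s i + Zᵀ *ᵥ u i) :
    s 0 ⬝ᵥ kalmanP Z T R Q P N *ᵥ s 0 ≤ s N ⬝ᵥ P *ᵥ s N +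
      ∑ i ∈ Finset.range N, (s i ⬝ᵥ Q *ᵥ s i + u i ⬝ᵥ R *ᵥ u i) := by
  induction N generalizing s u with
  | zero => simp [kalmanP]
  | succ N ih =>
    have h1 := riccatiMap_le_cost (Z := Z) (T := T) (Q := Q) hR
      (kalmanP_posSemidef hR hQ hP N : (kalmanP Z T R Q P N).PosSemidef) (s 0) (u 0)
    rw [← hs 0] at h1
    have h2 := ih (fun i => s (i + 1)) (fun i => u (i + 1)) fun i => hs (i + 1)
    rw [kalmanP_succ, Finset.sum_range_succ']
    simp only [zero_add] at h1 h2
    linarith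

end RiccatiStep

/-! ### Convergence of the Riccati recursion -/

section RiccatiConvergence

variable {m n : Type*} [Fintype m] [DecidableEq m] [Fintype n] [DecidableEq n]
  {Z : Matrix m n ℝ} {T : Matrix n n ℝ} {R : Matrix m m ℝ} {Q P : Matrix n n ℝ}

theorem exists_trajectory (Z : Matrix m n ℝ) (T : Matrix n n ℝ) (u : ℕ → m → ℝ) (x : n → ℝ) :
    ∃ s : ℕ → n → ℝ, s 0 = x ∧ ∀ i, s (i + 1) = Tᵀ *ᵥ s i + Zᵀ *ᵥ u i :=
  ⟨fun i => Nat.rec x (fun i s => Tᵀ *ᵥ s + Zᵀ *ᵥ u i) i, rfl, fun _ => rfl⟩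

/-- Variation of constants for the dual system. -/
theorem trajectory_eq_sum {s : ℕ → n → ℝ} {u : ℕ → m → ℝ}
    (hs : ∀ i, s (i + 1) = Tᵀ *ᵥ s i + Zᵀ *ᵥ u i) (N : ℕ) :
    s N = Tᵀ ^ N *ᵥ s 0 + ∑ i ∈ Finset.range N, (Tᵀ ^ (N - 1 - i) * Zᵀ) *ᵥ u i := by
  induction N with
  | zero => simp
  | succ N ih =>
    rw [hs, ih, mulVec_add, mulVec_mulVec, ← pow_succ', Finset.sum_range_succ, mulVec_sum,
      add_assoc]
    congr 2
    · refine Finset.sum_congr rfl fun i hi => ?_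
      have : N + 1 - 1 - i = (N - 1 - i) + 1 := by have := Finset.mem_range.1 hi; omega
      rw [mulVec_mulVec, this, pow_succ', Matrix.mul_assoc]
    · simp

/-- Observability of `(Z, T)` is controllability of the dual system: every state can be steered to
zero and kept there. -/
theorem IsObservable.exists_trajectory_eventually_zero (h : IsObservable Z T) (x : n → ℝ) :
    ∃ (s : ℕ → n → ℝ) (u : ℕ → m → ℝ), s 0 = x ∧ (∀ i, s (i + 1) = Tᵀ *ᵥ s i + Zᵀ *ᵥ u i) ∧
      ∀ i, Fintype.card n ≤ i → s i = 0 ∧ u i = 0 := by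
  obtain ⟨G, hG⟩ := exists_mul_eq_one_of_rank_eq_card h
  obtain ⟨w, hw⟩ : ∃ w, w = Gᵀ *ᵥ (-(Tᵀ ^ Fintype.card n *ᵥ x)) := ⟨_, rfl⟩
  -- `w` combines the vectors `(Tᵀ) ^ k Zᵀ e_j` to `-(Tᵀ) ^ card n x`; its `k`-th block is the
  -- control that still has `k` steps to act, so it is applied at time `card n - 1 - k`.
  let w' : ℕ → m → ℝ := fun k => if hk : k < Fintype.card n then fun j => w (⟨k, hk⟩, j) else 0
  let u : ℕ → m → ℝ := fun i => if i < Fintype.card n then w' (Fintype.card n - 1 - i) else 0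
  obtain ⟨s, hs0, hs⟩ := exists_trajectory Z T u x
  have hsum : ∑ i ∈ Finset.range (Fintype.card n), (Tᵀ ^ (Fintype.card n - 1 - i) * Zᵀ) *ᵥ u i =
      -(Tᵀ ^ Fintype.card n *ᵥ x) := by
    have h1 : ∑ i ∈ Finset.range (Fintype.card n), (Tᵀ ^ (Fintype.card n - 1 - i) * Zᵀ) *ᵥ u i =
        ∑ i ∈ Finset.range (Fintype.card n),
          (Tᵀ ^ (Fintype.card n - 1 - i) * Zᵀ) *ᵥ w' (Fintype.card n - 1 - i) :=
      Finset.sum_congr rfl fun i hi => by simp [u, Finset.mem_range.1 hi]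
    rw [h1, Finset.sum_range_reflect (fun i => (Tᵀ ^ i * Zᵀ) *ᵥ w' i), Finset.sum_range]
    have h2 := congrArg (fun M : Matrix n n ℝ => Mᵀ *ᵥ (-(Tᵀ ^ Fintype.card n *ᵥ x))) hG
    simp only [transpose_mul, transpose_one, one_mulVec] at h2
    rw [← mulVec_mulVec, ← hw] at h2
    rw [← h2]
    ext j
    simp only [Finset.sum_apply, mulVec, dotProduct, transpose_apply, of_apply,
      Fintype.sum_prod_type, w']
    refine Finset.sum_congr rfl fun k _ => Finset.sum_congr rfl fun i _ => ?_
    rw [← transpose_pow, ← transpose_mul, transpose_apply]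
    simp
  have hsN : s (Fintype.card n) = 0 := by rw [trajectory_eq_sum hs, hs0, hsum]; simp
  have hu : ∀ i, Fintype.card n ≤ i → u i = 0 := fun i hi => by simp [u, not_lt.2 hi]
  refine ⟨s, u, hs0, hs, fun i hi => ⟨?_, hu i hi⟩⟩
  induction i, hi using Nat.le_induction with
  | base => exact hsN
  | succ i hi ih => rw [hs, ih, hu i hi]; simp

theorem exists_kalmanP_zero_le (hR : R.PosDef) (hQ : Q.PosSemidef) (hobs : IsObservable Z T)
    (x : n → ℝ) : ∃ C, ∀ t, x ⬝ᵥ kalmanP Z T R Q 0 t *ᵥ x ≤ C := by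
  obtain ⟨s, u, rfl, hs, h0⟩ := hobs.exists_trajectory_eventually_zero x
  refine ⟨∑ i ∈ Finset.range (Fintype.card n), (s i ⬝ᵥ Q *ᵥ s i + u i ⬝ᵥ R *ᵥ u i), fun t => ?_⟩
  refine (kalmanP_zero_monotone hR hQ (s 0) (le_max_left t (Fintype.card n))).trans ?_
  refine (kalmanP_le_trajectory_cost hR hQ PosSemidef.zero _ s u hs).trans ?_
  rw [zero_mulVec, dotProduct_zero, zero_add]
  refine (Finset.sum_subset (Finset.range_mono (le_max_right _ _)) fun i _ hi => ?_).ge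
  obtain ⟨h1, h2⟩ := h0 i (by simpa using hi)
  simp [h1, h2]

theorem continuousAt_kalmanK (hR : R.PosDef) (hP : P.PosSemidef) :
    ContinuousAt (kalmanK Z R) P := by
  have hF : ContinuousAt (kalmanF Z R) P := by
    unfold kalmanF
    fun_prop
  have hinv : ContinuousAt (fun P => (kalmanF Z R P)⁻¹) P :=
    (continuousAt_inv_of_posDef (kalmanF_posDef Z hR hP)).comp hF
  unfold kalmanK
  fun_prop

theorem continuousAt_kalmanL (hR : R.PosDef) (hP : P.PosSemidef) :
    ContinuousAt (kalmanL Z R) P := by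
  have := continuousAt_kalmanK (Z := Z) hR hP
  unfold kalmanL
  fun_prop

theorem continuousAt_riccatiMap (hR : R.PosDef) (hP : P.PosSemidef) :
    ContinuousAt (riccatiMap Z T R Q) P := by
  have := continuousAt_kalmanL (Z := Z) hR hP
  unfold riccatiMap
  fun_prop

/-- Started at zero, the Riccati iterates increase and are bounded, hence converge to a solution of
the algebraic Riccati equation. -/
theorem exists_riccati_fixedPoint (hR : R.PosDef) (hQ : Q.PosSemidef) (hobs : IsObservable Z T) :
    ∃ S : Matrix n n ℝ, S.PosSemidef ∧ Tendsto (kalmanP Z T R Q 0) atTop (𝓝 S) ∧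
      riccatiMap Z T R Q S = S := by
  have hpsd := kalmanP_posSemidef (Z := Z) (T := T) hR hQ PosSemidef.zero
  have hconv : ∀ x : n → ℝ, ∃ l, Tendsto (fun t => x ⬝ᵥ kalmanP Z T R Q 0 t *ᵥ x) atTop (𝓝 l) :=
    fun x => by
      obtain ⟨C, hC⟩ := exists_kalmanP_zero_le hR hQ hobs x
      exact ⟨_, tendsto_atTop_ciSup (kalmanP_zero_monotone hR hQ x)
        ⟨C, Set.forall_mem_range.2 hC⟩⟩
  choose q hq using hconv
  have hlim := tendsto_of_tendsto_quadForm (fun t => (hpsd t).transpose_eq) hq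
  refine ⟨_, posSemidef_of_tendsto hpsd hlim, hlim, ?_⟩
  have h1 := (continuousAt_riccatiMap (Z := Z) (T := T) (Q := Q) hR
    (posSemidef_of_tendsto hpsd hlim)).tendsto.comp hlim
  exact tendsto_nhds_unique h1 ((tendsto_add_atTop_iff_nat 1).2 hlim)

theorem IsControllable.posSemidef (h : IsControllable T Q) : Q.PosSemidef := by
  obtain ⟨r, B, W, hW, rfl, -⟩ := h
  simpa [conjTranspose_eq_transpose_of_trivial] using hW.posSemidef.mul_mul_conjTranspose_same B

/-- Controllability of `(T, Q)` is observability of the dual state through its running cost: a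
trajectory whose state and control costs vanish in the limit tends to zero. -/
theorem IsControllable.tendsto_zero (h : IsControllable T Q) {s : ℕ → n → ℝ} {u : ℕ → m → ℝ}
    (hs : ∀ i, s (i + 1) = Tᵀ *ᵥ s i + Zᵀ *ᵥ u i)
    (hcost : Tendsto (fun i => s i ⬝ᵥ Q *ᵥ s i) atTop (𝓝 0)) (hu : Tendsto u atTop (𝓝 0)) :
    Tendsto s atTop (𝓝 0) := by
  obtain ⟨r, B, W, hW, rfl, hrank⟩ := h
  have hBs : Tendsto (fun i => Bᵀ *ᵥ s i) atTop (𝓝 0) := by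
    refine hW.tendsto_zero_of_quadForm (hcost.congr fun i => ?_)
    rw [← mulVec_mulVec, ← mulVec_mulVec, dotProduct_mulVec (s i) B, ← mulVec_transpose]
  -- The controls vanish in the limit, so `Bᵀ (Tᵀ) ^ k s i` and `Bᵀ s (i + k)` have the same limit.
  have hpow : ∀ k : ℕ, Tendsto (fun i => (Bᵀ * Tᵀ ^ k) *ᵥ s i) atTop (𝓝 0) := by
    intro k
    induction k with
    | zero => simpa using hBs
    | succ k ih =>
      have h1 : Tendsto (fun i => (Bᵀ * Tᵀ ^ k) *ᵥ s (i + 1)) atTop (𝓝 0) :=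
        (tendsto_add_atTop_iff_nat 1).2 ih
      have h2 : Tendsto (fun i => (Bᵀ * Tᵀ ^ k * Zᵀ) *ᵥ u i) atTop (𝓝 0) := by
        have := ((continuous_const.matrix_mulVec continuous_id :
          Continuous fun y => (Bᵀ * Tᵀ ^ k * Zᵀ) *ᵥ y).tendsto 0).comp hu
        simpa [Function.comp_def] using this
      have h3 := h1.sub h2
      rw [sub_zero] at h3
      refine h3.congr fun i => ?_
      rw [hs, mulVec_add, mulVec_mulVec, mulVec_mulVec, pow_succ, Matrix.mul_assoc,
        add_sub_cancel_right]
  rw [← rank_transpose] at hrank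
  obtain ⟨G, hG⟩ := exists_mul_eq_one_of_rank_eq_card hrank
  set O := (of fun (i : n) (kj : Fin (Fintype.card n) × Fin r) =>
    (T ^ (kj.1 : ℕ) * B) i kj.2)ᵀ with hO
  have hOs : Tendsto (fun i => O *ᵥ s i) atTop (𝓝 0) := by
    refine tendsto_pi_nhds.2 fun kj => ?_
    refine (tendsto_pi_nhds.1 (hpow kj.1) kj.2).congr fun i => ?_
    rw [← transpose_pow, ← transpose_mul]
    rfl
  have := ((continuous_const.matrix_mulVec continuous_id :
    Continuous fun y => G *ᵥ y).tendsto 0).comp hOs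
  simpa [Function.comp_def, mulVec_mulVec, hG] using this

/-- Convergence of the Riccati recursion from any positive semidefinite initial value, and
asymptotic stability of the limiting filter. -/
theorem riccati_convergence (hR : R.PosDef) (hobs : IsObservable Z T) (hctr : IsControllable T Q) :
    ∃ S : Matrix n n ℝ, S.PosSemidef ∧
      Tendsto (fun t => (T * kalmanL Z R S) ^ t) atTop (𝓝 0) ∧
      ∀ P : Matrix n n ℝ, P.PosSemidef → Tendsto (kalmanP Z T R Q P) atTop (𝓝 S) := by
  have hQ := hctr.posSemidef
  obtain ⟨S, hS, hlim, hfix⟩ := exists_riccati_fixedPoint hR hQ hobs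
  set A := (T * kalmanL Z R S)ᵀ with hA
  let s : (n → ℝ) → ℕ → n → ℝ := fun x i => A ^ i *ᵥ x
  let u : (n → ℝ) → ℕ → m → ℝ := fun x i => -((T * kalmanK Z R S)ᵀ *ᵥ s x i)
  have hs1 : ∀ x i, s x (i + 1) = A *ᵥ s x i := fun x i => by simp [s, pow_succ', mulVec_mulVec]
  have hs : ∀ x i, s x (i + 1) = Tᵀ *ᵥ s x i + Zᵀ *ᵥ u x i := fun x i => by
    rw [hs1, hA, transpose_mulVec_sub_gain]
  have hs0 : ∀ x, s x 0 = x := fun x => by simp [s]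
  -- Along the closed loop, the value function drops at each step by exactly the running cost.
  have hdrop : ∀ x i, s x i ⬝ᵥ S *ᵥ s x i = s x (i + 1) ⬝ᵥ S *ᵥ s x (i + 1) +
      (s x i ⬝ᵥ Q *ᵥ s x i + u x i ⬝ᵥ R *ᵥ u x i) := fun x i => by
    have := riccatiMap_eq_optimal_cost (Z := Z) (T := T) (Q := Q) hR hS (s x i)
    rwa [hfix, ← hA, ← hs1] at this
  have hq0 : ∀ x i, 0 ≤ s x i ⬝ᵥ Q *ᵥ s x i := fun x i => hQ.quadForm_nonneg _
  have hr0 : ∀ x i, 0 ≤ u x i ⬝ᵥ R *ᵥ u x i := fun x i => hR.posSemidef.quadForm_nonneg _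
  have hcost : ∀ x, Tendsto (fun i => s x i ⬝ᵥ Q *ᵥ s x i + u x i ⬝ᵥ R *ᵥ u x i) atTop (𝓝 0) := by
    intro x
    have hanti : Antitone fun i => s x i ⬝ᵥ S *ᵥ s x i :=
      antitone_nat_of_succ_le fun i => by linarith [hdrop x i, hq0 x i, hr0 x i]
    have hl := tendsto_atTop_ciInf hanti
      ⟨0, Set.forall_mem_range.2 fun i => hS.quadForm_nonneg _⟩
    have h2 := hl.sub ((tendsto_add_atTop_iff_nat 1).2 hl)
    rw [sub_self] at h2
    exact h2.congr fun i => by linarith [hdrop x i]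
  have hstab : ∀ x, Tendsto (s x) atTop (𝓝 0) := fun x =>
    hctr.tendsto_zero (hs x)
      (squeeze_zero (hq0 x) (fun i => le_add_of_nonneg_right (hr0 x i)) (hcost x))
      (hR.tendsto_zero_of_quadForm
        (squeeze_zero (hr0 x) (fun i => le_add_of_nonneg_left (hq0 x i)) (hcost x)))
  refine ⟨S, hS, tendsto_zero_of_transpose_mulVec fun x => ?_, fun P hP => ?_⟩
  · simpa [s, hA, transpose_pow] using hstab x
  have hquad : ∀ M : Matrix n n ℝ, Continuous fun y : n → ℝ => y ⬝ᵥ M *ᵥ y := fun M => by fun_prop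
  have hqconv : ∀ x : n → ℝ,
      Tendsto (fun t => x ⬝ᵥ kalmanP Z T R Q P t *ᵥ x) atTop (𝓝 (x ⬝ᵥ S *ᵥ x)) := by
    intro x
    have hform : Continuous fun M : Matrix n n ℝ => x ⬝ᵥ M *ᵥ x := by fun_prop
    have hlow := (hform.tendsto S).comp hlim
    have hsum : ∀ N, ∑ i ∈ Finset.range N, (s x i ⬝ᵥ Q *ᵥ s x i + u x i ⬝ᵥ R *ᵥ u x i) =
        x ⬝ᵥ S *ᵥ x - s x N ⬝ᵥ S *ᵥ s x N := by
      intro N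
      induction N with
      | zero => simp [hs0]
      | succ N ih => rw [Finset.sum_range_succ, ih, hdrop x N]; ring
    have hup : Tendsto (fun t => s x t ⬝ᵥ P *ᵥ s x t + (x ⬝ᵥ S *ᵥ x - s x t ⬝ᵥ S *ᵥ s x t)) atTop
        (𝓝 (x ⬝ᵥ S *ᵥ x)) := by
      have h1 := ((hquad P).tendsto 0).comp (hstab x)
      have h2 := ((hquad S).tendsto 0).comp (hstab x)
      simpa [Function.comp_def] using h1.add (h2.const_sub (x ⬝ᵥ S *ᵥ x))
    refine tendsto_of_tendsto_of_tendsto_of_le_of_le hlow hup (fun t => ?_) (fun t => ?_)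
    · exact kalmanP_mono_initial hR hQ PosSemidef.zero hP
        (fun x => by simpa using hP.quadForm_nonneg x) t x
    · have := kalmanP_le_trajectory_cost (P := P) hR hQ hP t (s x) (u x) (hs x)
      rwa [hs0, hsum] at this
  have h1 := tendsto_of_tendsto_quadForm
    (fun t => (kalmanP_posSemidef hR hQ hP t).transpose_eq) hqconv
  have h2 := tendsto_of_tendsto_quadForm (l := (atTop : Filter ℕ)) (P := fun _ => S)
    (fun _ => hS.transpose_eq) (fun x => tendsto_const_nhds (x := x ⬝ᵥ S *ᵥ x))
  rwa [← tendsto_nhds_unique h2 tendsto_const_nhds]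

end RiccatiConvergence

/-! ### Asymptotically stable linear recursions -/

section LinearRecursions

theorem tendsto_zero_of_eventually_le_mul_add {a b : ℕ → ℝ} {ρ : ℝ} (hρ0 : 0 ≤ ρ) (hρ1 : ρ < 1)
    (ha : ∀ t, 0 ≤ a t) (h : ∀ᶠ t in atTop, a (t + 1) ≤ ρ * a t + b t)
    (hb : Tendsto b atTop (𝓝 0)) : Tendsto a atTop (𝓝 0) := by
  refine tendsto_order.2 ⟨fun c hc => Eventually.of_forall fun t => hc.trans_le (ha t),
    fun ε hε => ?_⟩
  have hδ : 0 < ε / 2 * (1 - ρ) := mul_pos (by linarith) (by linarith)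
  obtain ⟨t₀, ht₀⟩ := eventually_atTop.1 (h.and (hb.eventually_le_const hδ))
  have hk : ∀ k, a (k + t₀) ≤ ε / 2 + ρ ^ k * a t₀ := by
    intro k
    induction k with
    | zero => simp; linarith
    | succ k ih =>
      obtain ⟨h1, h2⟩ := ht₀ (k + t₀) (by omega)
      rw [show k + 1 + t₀ = k + t₀ + 1 by ring, pow_succ']
      nlinarith [mul_le_mul_of_nonneg_left ih hρ0]
  have hlim : Tendsto (fun k => ε / 2 + ρ ^ k * a t₀) atTop (𝓝 (ε / 2)) := by
    simpa using ((tendsto_pow_atTop_nhds_zero_of_lt_one hρ0 hρ1).mul_const (a t₀)).const_add (ε / 2)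
  have hev := hlim.eventually_lt_const (show ε / 2 < ε by linarith)
  filter_upwards [eventually_ge_atTop t₀, (tendsto_sub_atTop_nat t₀).eventually hev] with t ht h
  simpa [Nat.sub_add_cancel ht] using (hk (t - t₀)).trans_lt h

variable {k : Type*} [Fintype k]

/-- The sum of the absolute values of the entries, which dominates the operator norm for the
sup norm of vectors. -/
def Matrix.entrySum {l : Type*} [Fintype l] (M : Matrix k l ℝ) : ℝ := ∑ i, ∑ j, |M i j|

theorem Matrix.entrySum_nonneg (M : Matrix k k ℝ) : 0 ≤ M.entrySum :=
  Finset.sum_nonneg fun _ _ => Finset.sum_nonneg fun _ _ => abs_nonneg _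

theorem Matrix.norm_mulVec_le_entrySum (M : Matrix k k ℝ) (x : k → ℝ) :
    ‖M *ᵥ x‖ ≤ M.entrySum * ‖x‖ := by
  refine (pi_norm_le_iff_of_nonneg (mul_nonneg M.entrySum_nonneg (norm_nonneg x))).2 fun i => ?_
  calc ‖(M *ᵥ x) i‖ ≤ ∑ j, ‖M i j * x j‖ := norm_sum_le _ _
    _ ≤ ∑ j, |M i j| * ‖x‖ := Finset.sum_le_sum fun j _ => by
        rw [norm_mul, Real.norm_eq_abs]
        exact mul_le_mul_of_nonneg_left (norm_le_pi_norm x j) (abs_nonneg _)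
    _ = (∑ j, |M i j|) * ‖x‖ := by rw [Finset.sum_mul]
    _ ≤ M.entrySum * ‖x‖ := by
        refine mul_le_mul_of_nonneg_right ?_ (norm_nonneg x)
        exact Finset.single_le_sum (f := fun i => ∑ j, |M i j|)
          (fun _ _ => Finset.sum_nonneg fun _ _ => abs_nonneg _) (Finset.mem_univ i)

theorem Matrix.tendsto_entrySum_zero {ι : Type*} {l : Filter ι} {M : ι → Matrix k k ℝ}
    (h : Tendsto M l (𝓝 0)) : Tendsto (fun i => (M i).entrySum) l (𝓝 0) := by
  have hc : Continuous fun M : Matrix k k ℝ => M.entrySum := by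
    unfold Matrix.entrySum
    fun_prop
  simpa [Function.comp_def, Matrix.entrySum] using (hc.tendsto 0).comp h

variable [DecidableEq k]

/-- A linear recursion whose coefficients converge to a matrix with powers tending to zero, driven
by an input that tends to zero, tends to zero. -/
theorem tendsto_zero_of_asymptotically_stable {B : ℕ → Matrix k k ℝ} {B' : Matrix k k ℝ}
    (hB : Tendsto B atTop (𝓝 B')) (hpow : Tendsto (fun t => B' ^ t) atTop (𝓝 0))
    {e δ : ℕ → k → ℝ} (he : ∀ t, e (t + 1) = B t *ᵥ e t + δ t) (hδ : Tendsto δ atTop (𝓝 0)) :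
    Tendsto e atTop (𝓝 0) := by
  obtain ⟨N, hN, hN1⟩ := (((tendsto_entrySum_zero hpow).eventually_le_const
    (show (0 : ℝ) < 1 / 2 by norm_num)).and (eventually_ge_atTop 1)).exists
  -- A Lyapunov function `h` for `B'`: since `‖B' ^ N x‖ ≤ ‖x‖ / 2`, one step of `B'` lowers `h x`
  -- by at least `‖x‖ / 2`, hence by a fixed fraction of it.
  obtain ⟨h, hh⟩ : ∃ h : (k → ℝ) → ℝ, ∀ x, h x = ∑ j ∈ Finset.range N, ‖B' ^ j *ᵥ x‖ :=
    ⟨_, fun _ => rfl⟩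
  obtain ⟨C, hCdef⟩ : ∃ C, C = ∑ j ∈ Finset.range N, (B' ^ j).entrySum + 1 := ⟨_, rfl⟩
  have hC1 : 1 ≤ C := by
    rw [hCdef]
    exact le_add_of_nonneg_left (Finset.sum_nonneg fun _ _ => entrySum_nonneg _)
  have hC0 : 0 < C := by linarith
  have hh0 : ∀ x, 0 ≤ h x := fun x => by
    rw [hh]; exact Finset.sum_nonneg fun _ _ => norm_nonneg _
  have hlow : ∀ x, ‖x‖ ≤ h x := fun x => by
    rw [hh]
    simpa using Finset.single_le_sum (f := fun j => ‖B' ^ j *ᵥ x‖) (fun _ _ => norm_nonneg _)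
      (Finset.mem_range.2 hN1)
  have hup : ∀ x, h x ≤ C * ‖x‖ := fun x => by
    rw [hh, hCdef, add_mul, Finset.sum_mul]
    have : ∑ j ∈ Finset.range N, ‖B' ^ j *ᵥ x‖ ≤ ∑ j ∈ Finset.range N, (B' ^ j).entrySum * ‖x‖ :=
      Finset.sum_le_sum fun j _ => norm_mulVec_le_entrySum _ _
    linarith [norm_nonneg x]
  have hadd : ∀ x y, h (x + y) ≤ h x + h y := fun x y => by
    rw [hh, hh, hh, ← Finset.sum_add_distrib]
    exact Finset.sum_le_sum fun j _ => by rw [mulVec_add]; exact norm_add_le _ _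
  have hdec : ∀ x, h (B' *ᵥ x) ≤ h x - 1 / 2 * ‖x‖ := fun x => by
    have h1 : h (B' *ᵥ x) + ‖x‖ = h x + ‖B' ^ N *ᵥ x‖ := by
      rw [hh, hh, ← Finset.sum_range_succ (fun j => ‖B' ^ j *ᵥ x‖), Finset.sum_range_succ']
      simp [mulVec_mulVec, ← pow_succ]
    have h2 := (norm_mulVec_le_entrySum (B' ^ N) x).trans
      (mul_le_mul_of_nonneg_right hN (norm_nonneg x))
    linarith
  have hγ : Tendsto (fun t => (B t - B').entrySum) atTop (𝓝 0) :=
    tendsto_entrySum_zero (by simpa using hB.sub_const B')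
  have hδn : Tendsto (fun t => C * ‖δ t‖) atTop (𝓝 0) := by simpa using hδ.norm.const_mul C
  refine squeeze_zero_norm (fun t => hlow (e t)) ?_
  have hq : 0 < 1 / (4 * C) := by positivity
  have hq1 : 1 / (4 * C) ≤ 1 := by rw [div_le_one (by positivity)]; linarith
  refine tendsto_zero_of_eventually_le_mul_add (ρ := 1 - 1 / (4 * C)) (by linarith) (by linarith)
    (fun t => hh0 _) ?_ hδn
  filter_upwards [hγ.eventually_le_const (show 0 < 1 / (4 * C) / C by positivity)] with t ht
  have e1 : e (t + 1) = B' *ᵥ e t + ((B t - B') *ᵥ e t + δ t) := by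
    rw [he, sub_mulVec]; abel
  have h1 := hadd (B' *ᵥ e t) ((B t - B') *ᵥ e t + δ t)
  have h2 := hadd ((B t - B') *ᵥ e t) (δ t)
  have h3 : h ((B t - B') *ᵥ e t) ≤ 1 / (4 * C) * h (e t) := by
    refine (hup _).trans ?_
    have := (norm_mulVec_le_entrySum (B t - B') (e t)).trans
      (mul_le_mul ht (hlow _) (norm_nonneg _) (by positivity))
    calc C * ‖(B t - B') *ᵥ e t‖ ≤ C * (1 / (4 * C) / C * h (e t)) := by gcongr
      _ = 1 / (4 * C) * h (e t) := by field_simp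
  have h4 : 1 / (2 * C) * h (e t) ≤ 1 / 2 * ‖e t‖ := by
    calc 1 / (2 * C) * h (e t) ≤ 1 / (2 * C) * (C * ‖e t‖) := by gcongr; exact hup _
      _ = 1 / 2 * ‖e t‖ := by field_simp
  have h5 : 1 / (2 * C) = 1 / (4 * C) + 1 / (4 * C) := by field_simp; norm_num
  have h6 := hdec (e t)
  rw [e1]
  rw [h5] at h4
  linarith [hup (δ t)]

/-- With a convergent input instead, such a recursion converges to the unique fixed point of the
limiting affine map. -/
theorem exists_tendsto_of_asymptotically_stable {B : ℕ → Matrix k k ℝ} {B' : Matrix k k ℝ}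
    (hB : Tendsto B atTop (𝓝 B')) (hpow : Tendsto (fun t => B' ^ t) atTop (𝓝 0))
    {v w : ℕ → k → ℝ} {w' : k → ℝ} (hv : ∀ t, v (t + 1) = B t *ᵥ v t + w t)
    (hw : Tendsto w atTop (𝓝 w')) : ∃ v', Tendsto v atTop (𝓝 v') := by
  have hinj : Function.Injective (1 - B').mulVecLin := by
    rw [← LinearMap.ker_eq_bot, LinearMap.ker_eq_bot']
    intro x hx
    have hx1 : B' *ᵥ x = x := by
      rw [mulVecLin_apply, sub_mulVec, one_mulVec, sub_eq_zero] at hx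
      exact hx.symm
    have hx2 : ∀ t : ℕ, B' ^ t *ᵥ x = x := fun t => by
      induction t with
      | zero => simp
      | succ t ih => rw [pow_succ, ← mulVec_mulVec, hx1, ih]
    have hc : Continuous fun M : Matrix k k ℝ => M *ᵥ x := by fun_prop
    have := (hc.tendsto 0).comp hpow
    simp only [Function.comp_def, hx2, zero_mulVec] at this
    exact tendsto_nhds_unique tendsto_const_nhds this
  obtain ⟨v', hv'⟩ := LinearMap.injective_iff_surjective.1 hinj w'
  have hfix : v' = B' *ᵥ v' + w' := by
    rw [← hv', mulVecLin_apply, sub_mulVec, one_mulVec]; abel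
  refine ⟨v', tendsto_sub_nhds_zero_iff.1 ?_⟩
  refine tendsto_zero_of_asymptotically_stable hB hpow (e := fun t => v t - v')
    (δ := fun t => (B t - B') *ᵥ v' + (w t - w')) (fun t => ?_) ?_
  · rw [hv, mulVec_sub, sub_mulVec]
    nth_rewrite 1 [hfix]
    abel
  · have hc : Continuous fun M : Matrix k k ℝ => (M - B') *ᵥ v' := by fun_prop
    simpa [Function.comp_def] using ((hc.tendsto B').comp hB).add (hw.sub_const w')

open scoped Kronecker in
/-- Vectorizing `V ↦ A V Aᵀ` as `A ⊗ A` reduces the Lyapunov recursion to the vector case. -/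
theorem exists_tendsto_of_lyapunov_recursion {n : Type*} [Fintype n] [DecidableEq n]
    {A V W : ℕ → Matrix n n ℝ} {A' W' : Matrix n n ℝ} (hA : Tendsto A atTop (𝓝 A'))
    (hpow : Tendsto (fun t => A' ^ t) atTop (𝓝 0))
    (hV : ∀ t, V (t + 1) = A t * V t * (A t)ᵀ + W t) (hW : Tendsto W atTop (𝓝 W')) :
    ∃ V', Tendsto V atTop (𝓝 V') := by
  have hK : Continuous fun M : Matrix n n ℝ => M ⊗ₖ M := by
    refine continuous_pi fun i => continuous_pi fun j => ?_
    simp only [kroneckerMap_apply]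
    fun_prop
  have hKpow : ∀ t : ℕ, (A' ⊗ₖ A') ^ t = (A' ^ t) ⊗ₖ (A' ^ t) := fun t => by
    induction t with
    | zero => simp
    | succ t ih => rw [pow_succ, ih, ← mul_kronecker_mul, ← pow_succ]
  have hvec : Continuous fun M : Matrix n n ℝ => vec M :=
    continuous_pi fun ij => by unfold vec; fun_prop
  obtain ⟨v', hv'⟩ := exists_tendsto_of_asymptotically_stable (B := fun t => A t ⊗ₖ A t)
    (v := fun t => vec (V t)) (w := fun t => vec (W t)) ((hK.tendsto A').comp hA)
    (by simpa [Function.comp_def, hKpow] using (hK.tendsto 0).comp hpow)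
    (fun t => by rw [kronecker_mulVec_vec, hV, vec_add]) ((hvec.tendsto W').comp hW)
  exact ⟨of fun i j => v' (j, i), tendsto_pi_nhds.2 fun i => tendsto_pi_nhds.2 fun j =>
    tendsto_pi_nhds.1 hv' (j, i)⟩

end LinearRecursions

/-! ### Means and cross-covariances of random vectors -/

section Moments

variable {Ω : Type*} [MeasurableSpace Ω] {μ : Measure Ω} {ι κ l : Type*}

/-- A random vector all of whose coordinates are square integrable. -/
def IsSquareIntegrable (X : Ω → ι → ℝ) (μ : Measure Ω) : Prop := ∀ i, MemLp (fun ω => X ω i) 2 μ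

/-- The matrix of cross-covariances of two random vectors. -/
noncomputable def crossCov (μ : Measure Ω) (X : Ω → ι → ℝ) (Y : Ω → κ → ℝ) : Matrix ι κ ℝ :=
  Matrix.of fun i j => cov[fun ω => X ω i, fun ω => Y ω j; μ]

theorem covMat_eq_crossCov (X : Ω → ι → ℝ) : covMat μ X = crossCov μ X X := rfl

theorem uncorrelated_iff_crossCov_eq_zero {X : Ω → ι → ℝ} {Y : Ω → κ → ℝ} :
    Uncorrelated X Y μ ↔ crossCov μ X Y = 0 := by
  simp [Uncorrelated, ← Matrix.ext_iff, crossCov]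

theorem transpose_crossCov (X : Ω → ι → ℝ) (Y : Ω → κ → ℝ) :
    (crossCov μ X Y)ᵀ = crossCov μ Y X := by
  ext i j; exact covariance_comm _ _

variable {X X' : Ω → ι → ℝ} {Y Y' : Ω → κ → ℝ}

theorem IsSquareIntegrable.add (hX : IsSquareIntegrable X μ) (hX' : IsSquareIntegrable X' μ) :
    IsSquareIntegrable (fun ω => X ω + X' ω) μ := fun i => (hX i).add (hX' i)

theorem IsSquareIntegrable.sub (hX : IsSquareIntegrable X μ) (hX' : IsSquareIntegrable X' μ) :
    IsSquareIntegrable (fun ω => X ω - X' ω) μ := fun i => (hX i).sub (hX' i)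

theorem IsSquareIntegrable.mulVec [Fintype κ] (hY : IsSquareIntegrable Y μ) (M : Matrix ι κ ℝ) :
    IsSquareIntegrable (fun ω => M *ᵥ Y ω) μ := fun i =>
  memLp_finsetSum Finset.univ fun j _ => (hY j).const_mul (M i j)

section Finite

variable [IsFiniteMeasure μ]

theorem crossCov_add_left (hX : IsSquareIntegrable X μ) (hX' : IsSquareIntegrable X' μ)
    (hY : IsSquareIntegrable Y μ) :
    crossCov μ (fun ω => X ω + X' ω) Y = crossCov μ X Y + crossCov μ X' Y := by
  ext i j; exact covariance_add_left (hX i) (hX' i) (hY j)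

theorem crossCov_sub_left (hX : IsSquareIntegrable X μ) (hX' : IsSquareIntegrable X' μ)
    (hY : IsSquareIntegrable Y μ) :
    crossCov μ (fun ω => X ω - X' ω) Y = crossCov μ X Y - crossCov μ X' Y := by
  ext i j; exact covariance_sub_left (hX i) (hX' i) (hY j)

theorem crossCov_add_right (hX : IsSquareIntegrable X μ) (hY : IsSquareIntegrable Y μ)
    (hY' : IsSquareIntegrable Y' μ) :
    crossCov μ X (fun ω => Y ω + Y' ω) = crossCov μ X Y + crossCov μ X Y' := by
  ext i j; exact covariance_add_right (hX i) (hY j) (hY' j)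

theorem crossCov_sub_right (hX : IsSquareIntegrable X μ) (hY : IsSquareIntegrable Y μ)
    (hY' : IsSquareIntegrable Y' μ) :
    crossCov μ X (fun ω => Y ω - Y' ω) = crossCov μ X Y - crossCov μ X Y' := by
  ext i j; exact covariance_sub_right (hX i) (hY j) (hY' j)

theorem crossCov_mulVec_left [Fintype ι] (hX : IsSquareIntegrable X μ)
    (hY : IsSquareIntegrable Y μ) (M : Matrix l ι ℝ) :
    crossCov μ (fun ω => M *ᵥ X ω) Y = M * crossCov μ X Y := by
  ext i j
  simp only [crossCov, of_apply, mulVec, dotProduct, mul_apply]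
  rw [covariance_fun_sum_left (fun k => (hX k).const_mul (M i k)) (hY j)]
  simp_rw [covariance_const_mul_left]

theorem crossCov_mulVec_right [Fintype κ] (hX : IsSquareIntegrable X μ)
    (hY : IsSquareIntegrable Y μ) (M : Matrix l κ ℝ) :
    crossCov μ X (fun ω => M *ᵥ Y ω) = crossCov μ X Y * Mᵀ := by
  rw [← transpose_crossCov, crossCov_mulVec_left hY hX, transpose_mul, transpose_crossCov]

theorem covMat_add (hX : IsSquareIntegrable X μ) (hX' : IsSquareIntegrable X' μ) :
    covMat μ (fun ω => X ω + X' ω) =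
      covMat μ X + crossCov μ X X' + (crossCov μ X X')ᵀ + covMat μ X' := by
  simp only [covMat_eq_crossCov]
  rw [crossCov_add_left hX hX' (hX.add hX'), crossCov_add_right hX hX hX',
    crossCov_add_right hX' hX hX', transpose_crossCov]
  abel

theorem covMat_mulVec [Fintype ι] (hX : IsSquareIntegrable X μ) (M : Matrix l ι ℝ) :
    covMat μ (fun ω => M *ᵥ X ω) = M * covMat μ X * Mᵀ := by
  simp only [covMat_eq_crossCov]
  rw [crossCov_mulVec_left hX (hX.mulVec M), crossCov_mulVec_right hX hX, Matrix.mul_assoc]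

theorem abs_covariance_le_variance_add_variance {f g : Ω → ℝ} (hf : MemLp f 2 μ)
    (hg : MemLp g 2 μ) : |cov[f, g; μ]| ≤ Var[f; μ] + Var[g; μ] := by
  have h1 := variance_add hf hg
  have h2 := variance_sub hf hg
  have h3 := variance_nonneg (f + g) μ
  have h4 := variance_nonneg (f - g) μ
  have h5 := variance_nonneg f μ
  have h6 := variance_nonneg g μ
  rw [abs_le]
  constructor <;> linarith

theorem meanVec_add (hX : IsSquareIntegrable X μ) (hX' : IsSquareIntegrable X' μ) :
    meanVec μ (fun ω => X ω + X' ω) = meanVec μ X + meanVec μ X' := by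
  ext i
  exact integral_add ((hX i).integrable one_le_two) ((hX' i).integrable one_le_two)

theorem meanVec_sub (hX : IsSquareIntegrable X μ) (hX' : IsSquareIntegrable X' μ) :
    meanVec μ (fun ω => X ω - X' ω) = meanVec μ X - meanVec μ X' := by
  ext i
  exact integral_sub ((hX i).integrable one_le_two) ((hX' i).integrable one_le_two)

theorem meanVec_mulVec [Fintype ι] (hX : IsSquareIntegrable X μ) (M : Matrix l ι ℝ) :
    meanVec μ (fun ω => M *ᵥ X ω) = M *ᵥ meanVec μ X := by
  ext i
  simp only [meanVec, mulVec, dotProduct]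
  rw [integral_finsetSum _ fun j _ => ((hX j).integrable one_le_two).const_mul _]
  simp_rw [integral_const_mul]

end Finite

section Normal

variable [Fintype ι] [DecidableEq ι] {m : ι → ℝ} {S : Matrix ι ι ℝ}

theorem IsNormal.isSquareIntegrable (h : IsNormal X m S μ) : IsSquareIntegrable X μ := by
  intro i
  have h1 : MemLp (fun x : EuclideanSpace ℝ ι => x i) 2
      (multivariateGaussian (WithLp.toLp 2 m) S) :=
    (EuclideanSpace.proj (𝕜 := ℝ) i).comp_memLp' IsGaussian.memLp_two_id
  rw [← h.2.map_eq] at h1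
  exact h1.comp_of_map h.2.aemeasurable

theorem IsNormal.meanVec_eq (h : IsNormal X m S μ) : meanVec μ X = m := by
  ext i
  have h1 := h.2.integral_comp (f := fun x : EuclideanSpace ℝ ι => x i) (by fun_prop)
  have h2 := (EuclideanSpace.proj (𝕜 := ℝ) i).integral_comp_comm
    (IsGaussian.integrable_id (μ := multivariateGaussian (WithLp.toLp 2 m) S))
  simp only [id, integral_id_multivariateGaussian] at h2
  exact h1.trans h2

theorem IsNormal.covMat_eq (h : IsNormal X m S μ) : covMat μ X = S := by
  ext i j
  have h1 := h.2.covariance_fun_comp (f := fun x : EuclideanSpace ℝ ι => x i)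
    (g := fun x : EuclideanSpace ℝ ι => x j) (by fun_prop) (by fun_prop)
  rw [covariance_eval_multivariateGaussian h.1] at h1
  exact h1

end Normal

end Moments

/-! ### Linear recursions driven by noise -/

section StochasticRecursion

variable {Ω : Type*} [MeasurableSpace Ω] {μ : Measure Ω} [IsFiniteMeasure μ]
  {m n : Type*} [Fintype n] [DecidableEq n] {A : ℕ → Matrix n n ℝ} {A' : Matrix n n ℝ}
  {x N : ℕ → Ω → n → ℝ}

theorem isSquareIntegrable_of_recursion (hx : ∀ t ω, x (t + 1) ω = A t *ᵥ x t ω + N t ω)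
    (hx0 : IsSquareIntegrable (x 0) μ) (hN : ∀ t, IsSquareIntegrable (N t) μ) (t : ℕ) :
    IsSquareIntegrable (x t) μ := by
  induction t with
  | zero => exact hx0
  | succ t ih =>
    rw [show x (t + 1) = _ from funext (hx t)]
    exact (ih.mulVec (A t)).add (hN t)

theorem tendsto_meanVec_zero_of_recursion (hA : Tendsto A atTop (𝓝 A'))
    (hpow : Tendsto (fun t => A' ^ t) atTop (𝓝 0))
    (hx : ∀ t ω, x (t + 1) ω = A t *ᵥ x t ω + N t ω)
    (hx0 : IsSquareIntegrable (x 0) μ) (hN : ∀ t, IsSquareIntegrable (N t) μ)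
    (hmean : ∀ t, meanVec μ (N t) = 0) : Tendsto (fun t => meanVec μ (x t)) atTop (𝓝 0) := by
  refine tendsto_zero_of_asymptotically_stable hA hpow (δ := 0) (fun t => ?_) tendsto_const_nhds
  have hxt := isSquareIntegrable_of_recursion hx hx0 hN t
  rw [show x (t + 1) = _ from funext (hx t), meanVec_add (hxt.mulVec (A t)) (hN t),
    meanVec_mulVec hxt, hmean, Pi.zero_apply]

/-- Random vectors `Y t` of constant variance that are uncorrelated with the past inputs are
correlated with the state only through the initial state, and this correlation is forgotten. -/
theorem tendsto_crossCov_zero_of_recursion [Fintype m] (hA : Tendsto A atTop (𝓝 A'))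
    (hpow : Tendsto (fun t => A' ^ t) atTop (𝓝 0))
    (hx : ∀ t ω, x (t + 1) ω = A t *ᵥ x t ω + N t ω)
    (hx0 : IsSquareIntegrable (x 0) μ) (hN : ∀ t, IsSquareIntegrable (N t) μ)
    {Y : ℕ → Ω → m → ℝ} (hY : ∀ t, IsSquareIntegrable (Y t) μ) {S : Matrix m m ℝ}
    (hvar : ∀ t, covMat μ (Y t) = S) (hNY : ∀ k t, k < t → crossCov μ (N k) (Y t) = 0) :
    Tendsto (fun t => crossCov μ (x t) (Y t)) atTop (𝓝 0) := by
  -- `Φ t` is the transition matrix from time `0` to time `t`.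
  obtain ⟨Φ, hΦ0, hΦ⟩ : ∃ Φ : ℕ → Matrix n n ℝ, Φ 0 = 1 ∧ ∀ t, Φ (t + 1) = A t * Φ t :=
    ⟨fun t => Nat.rec 1 (fun t M => A t * M) t, rfl, fun _ => rfl⟩
  have hcross : ∀ s t, s ≤ t → crossCov μ (x s) (Y t) = Φ s * crossCov μ (x 0) (Y t) := by
    intro s t hst
    induction s with
    | zero => rw [hΦ0, Matrix.one_mul]
    | succ s ih =>
      have hxs := isSquareIntegrable_of_recursion hx hx0 hN s
      rw [show x (s + 1) = _ from funext (hx s), crossCov_add_left (hxs.mulVec (A s)) (hN s) (hY t),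
        crossCov_mulVec_left hxs (hY t), ih (by omega), hNY s t (by omega), hΦ, add_zero,
        Matrix.mul_assoc]
  have hΦlim : Tendsto Φ atTop (𝓝 0) := by
    refine tendsto_pi_nhds.2 fun i => tendsto_pi_nhds.2 fun j => ?_
    have := tendsto_zero_of_asymptotically_stable hA hpow (e := fun t => Φ t *ᵥ Pi.single j 1)
      (δ := 0) (fun t => by simp only [hΦ, ← mulVec_mulVec, Pi.zero_apply, add_zero])
      tendsto_const_nhds
    simpa using tendsto_pi_nhds.1 this i
  have hbdd : ∀ (k : n) (j : m) t, |crossCov μ (x 0) (Y t) k j| ≤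
      Var[fun ω => x 0 ω k; μ] + S j j := fun k j t => by
    have h1 := abs_covariance_le_variance_add_variance (hx0 k) (hY t j)
    rwa [← covariance_self (hY t j).aemeasurable,
      show cov[fun ω => Y t ω j, fun ω => Y t ω j; μ] = S j j from
        congrFun (congrFun (hvar t) j) j] at h1
  refine tendsto_pi_nhds.2 fun i => tendsto_pi_nhds.2 fun j => ?_
  simp only [fun t => hcross t t le_rfl, mul_apply]
  rw [show (0 : Matrix n m ℝ) i j = ∑ _k : n, (0 : ℝ) by simp]
  refine tendsto_finsetSum _ fun k _ => ?_
  have h1 : Tendsto (fun t => |Φ t i k| * (Var[fun ω => x 0 ω k; μ] + S j j)) atTop (𝓝 0) := by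
    simpa using (tendsto_pi_nhds.1 (tendsto_pi_nhds.1 hΦlim i) k).abs.mul_const
      (Var[fun ω => x 0 ω k; μ] + S j j)
  refine squeeze_zero_norm (fun t => ?_) h1
  rw [norm_mul, Real.norm_eq_abs, Real.norm_eq_abs]
  exact mul_le_mul_of_nonneg_left (hbdd k j t) (abs_nonneg _)

theorem exists_tendsto_covMat_of_recursion (hA : Tendsto A atTop (𝓝 A'))
    (hpow : Tendsto (fun t => A' ^ t) atTop (𝓝 0))
    (hx : ∀ t ω, x (t + 1) ω = A t *ᵥ x t ω + N t ω)
    (hx0 : IsSquareIntegrable (x 0) μ) (hN : ∀ t, IsSquareIntegrable (N t) μ)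
    {W : Matrix n n ℝ} (hW : Tendsto (fun t => covMat μ (N t)) atTop (𝓝 W))
    (hxN : Tendsto (fun t => crossCov μ (x t) (N t)) atTop (𝓝 0)) :
    ∃ V, Tendsto (fun t => covMat μ (x t)) atTop (𝓝 V) := by
  have hAC : Tendsto (fun t => A t * crossCov μ (x t) (N t)) atTop (𝓝 0) := by
    have hc : Continuous fun p : Matrix n n ℝ × Matrix n n ℝ => p.1 * p.2 := by fun_prop
    simpa [Function.comp_def] using (hc.tendsto (A', 0)).comp (hA.prodMk_nhds hxN)
  have hACt : Tendsto (fun t => (A t * crossCov μ (x t) (N t))ᵀ) atTop (𝓝 0) := by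
    simpa [Function.comp_def] using ((continuous_id.matrix_transpose).tendsto 0).comp hAC
  refine exists_tendsto_of_lyapunov_recursion hA hpow (fun t => ?_) ((hAC.add hACt).add hW)
  have hxt := isSquareIntegrable_of_recursion hx hx0 hN t
  rw [show x (t + 1) = _ from funext (hx t), covMat_add (hxt.mulVec (A t)) (hN t),
    covMat_mulVec hxt, crossCov_mulVec_left hxt (hN t)]
  simp only [add_assoc]

end StochasticRecursion

/-! ### The forecast error of the misspecified filter -/

section ForecastError

variable {Ω : Type*} [MeasurableSpace Ω] {μ : Measure Ω} [IsProbabilityMeasure μ]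
  {m n : Type*} [Fintype m] [DecidableEq m] [Fintype n] [DecidableEq n]
  {Z : Matrix m n ℝ} {T : Matrix n n ℝ} {Sε : Matrix m m ℝ} {Sη : Matrix n n ℝ}
  {a₁ : n → ℝ} {P₁ : Matrix n n ℝ} {y : ℕ → Ω → m → ℝ} {α : ℕ → Ω → n → ℝ}
  {ε : ℕ → Ω → m → ℝ} {η : ℕ → Ω → n → ℝ}

/-- The forecast errors of a Kalman filter run with arbitrary covariances `R`, `Q` have
asymptotically constant first and second moments, provided the filter itself is observable and
controllable. -/
theorem IsStateSpaceModel.tendsto_moments_kalmanV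
    (hmodel : IsStateSpaceModel μ Z T Sε Sη a₁ P₁ y α ε η) {R : Matrix m m ℝ} {Q P : Matrix n n ℝ}
    (hR : R.PosDef) (hobs : IsObservable Z T) (hctr : IsControllable T Q) (hP : P.PosSemidef)
    (a : n → ℝ) :
    (∀ t, IsSquareIntegrable (fun ω => kalmanV Z T R Q a P (fun s => y s ω) t) μ) ∧
    Tendsto (fun t => meanVec μ fun ω => kalmanV Z T R Q a P (fun s => y s ω) t) atTop (𝓝 0) ∧
    ∃ V, Tendsto (fun t => covMat μ fun ω => kalmanV Z T R Q a P (fun s => y s ω) t)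
      atTop (𝓝 V) := by
  obtain ⟨S, hS, hpow, hconv⟩ := riccati_convergence hR hobs hctr
  have hlim := hconv P hP
  obtain ⟨A, hAdef⟩ : ∃ A, A = fun t => T * kalmanL Z R (kalmanP Z T R Q P t) := ⟨_, rfl⟩
  obtain ⟨G, hGdef⟩ : ∃ G, G = fun t => T * kalmanK Z R (kalmanP Z T R Q P t) := ⟨_, rfl⟩
  have hA : Tendsto A atTop (𝓝 (T * kalmanL Z R S)) := by
    have hc : Continuous fun M : Matrix n n ℝ => T * M := by fun_prop
    rw [hAdef]
    exact (hc.tendsto _).comp ((continuousAt_kalmanL hR hS).tendsto.comp hlim)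
  have hG : Tendsto G atTop (𝓝 (T * kalmanK Z R S)) := by
    have hc : Continuous fun M : Matrix n m ℝ => T * M := by fun_prop
    rw [hGdef]
    exact (hc.tendsto _).comp ((continuousAt_kalmanK hR hS).tendsto.comp hlim)
  have hAG : ∀ t, A t = T - G t * Z := fun t => by
    rw [hAdef, hGdef]
    simp only [kalmanL, Matrix.mul_sub, Matrix.mul_one, Matrix.mul_assoc]
  -- The state prediction error and the noise driving it.
  obtain ⟨x, hxdef⟩ : ∃ x : ℕ → Ω → n → ℝ,
      x = fun t ω => α t ω - kalmanA Z T R Q a P (fun s => y s ω) t := ⟨_, rfl⟩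
  obtain ⟨N, hNdef⟩ : ∃ N : ℕ → Ω → n → ℝ, N = fun t ω => η t ω - G t *ᵥ ε t ω := ⟨_, rfl⟩
  have hv : ∀ t ω, kalmanV Z T R Q a P (fun s => y s ω) t = Z *ᵥ x t ω + ε t ω := fun t ω => by
    rw [kalmanV, hmodel.observation, hxdef, mulVec_sub]
    abel
  have hx : ∀ t ω, x (t + 1) ω = A t *ᵥ x t ω + N t ω := fun t ω => by
    have h1 : kalmanA Z T R Q a P (fun s => y s ω) (t + 1) =
        T *ᵥ kalmanA Z T R Q a P (fun s => y s ω) t +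
          G t *ᵥ kalmanV Z T R Q a P (fun s => y s ω) t := by
      rw [hGdef]; rfl
    have h2 : x (t + 1) ω = α (t + 1) ω - kalmanA Z T R Q a P (fun s => y s ω) (t + 1) := by
      rw [hxdef]
    have h3 : T *ᵥ x t ω = T *ᵥ α t ω - T *ᵥ kalmanA Z T R Q a P (fun s => y s ω) t := by
      rw [hxdef, mulVec_sub]
    rw [h2, h1, hv, hmodel.transition, hAG, sub_mulVec, h3, hNdef, mulVec_add, mulVec_mulVec]
    ext i
    simp only [Pi.add_apply, Pi.sub_apply]
    ring
  have hεL := fun t => (hmodel.obs_noise t).isSquareIntegrable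
  have hηL := fun t => (hmodel.state_noise t).isSquareIntegrable
  have hN : ∀ t, IsSquareIntegrable (N t) μ := fun t => by
    rw [hNdef]; exact (hηL t).sub ((hεL t).mulVec (G t))
  have hx0 : IsSquareIntegrable (x 0) μ := by
    rw [hxdef]
    exact hmodel.initial.isSquareIntegrable.sub fun i => memLp_const (a i)
  have hxL := isSquareIntegrable_of_recursion hx hx0 hN
  have hεη : ∀ k t, crossCov μ (ε k) (η t) = 0 := fun k t =>
    uncorrelated_iff_crossCov_eq_zero.1 (hmodel.uncorr_obs_state k t)
  have hηε : ∀ k t, crossCov μ (η k) (ε t) = 0 := fun k t => by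
    rw [← transpose_crossCov, hεη, transpose_zero]
  have hxε : Tendsto (fun t => crossCov μ (x t) (ε t)) atTop (𝓝 0) := by
    refine tendsto_crossCov_zero_of_recursion hA hpow hx hx0 hN hεL
      (fun t => (hmodel.obs_noise t).covMat_eq) fun k t hkt => ?_
    have h1 := uncorrelated_iff_crossCov_eq_zero.1 (hmodel.uncorr_obs k t hkt.ne)
    rw [hNdef, crossCov_sub_left (hηL k) ((hεL k).mulVec (G k)) (hεL t),
      crossCov_mulVec_left (hεL k) (hεL t), h1, hηε, Matrix.mul_zero, sub_zero]
  have hxη : Tendsto (fun t => crossCov μ (x t) (η t)) atTop (𝓝 0) := by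
    refine tendsto_crossCov_zero_of_recursion hA hpow hx hx0 hN hηL
      (fun t => (hmodel.state_noise t).covMat_eq) fun k t hkt => ?_
    have h1 := uncorrelated_iff_crossCov_eq_zero.1 (hmodel.uncorr_state k t hkt.ne)
    rw [hNdef, crossCov_sub_left (hηL k) ((hεL k).mulVec (G k)) (hηL t),
      crossCov_mulVec_left (hεL k) (hηL t), h1, hεη, Matrix.mul_zero, sub_zero]
  have hxN : Tendsto (fun t => crossCov μ (x t) (N t)) atTop (𝓝 0) := by
    have hc : Continuous fun p : Matrix n m ℝ × Matrix n m ℝ => p.1 * p.2ᵀ := by fun_prop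
    have h1 := hxη.sub ((hc.tendsto (0, T * kalmanK Z R S)).comp (hxε.prodMk_nhds hG))
    rw [Matrix.zero_mul, sub_zero] at h1
    refine h1.congr fun t => ?_
    rw [hNdef, crossCov_sub_right (hxL t) (hηL t) ((hεL t).mulVec (G t)),
      crossCov_mulVec_right (hxL t) (hεL t)]
    rfl
  have hNcov : ∀ t, covMat μ (N t) = Sη + G t * Sε * (G t)ᵀ := fun t => by
    have hGε := (hεL t).mulVec (G t)
    rw [covMat_eq_crossCov, hNdef, crossCov_sub_left (hηL t) hGε ((hηL t).sub hGε),
      crossCov_sub_right (hηL t) (hηL t) hGε, crossCov_sub_right hGε (hηL t) hGε,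
      crossCov_mulVec_right (hηL t) (hεL t), crossCov_mulVec_left (hεL t) (hηL t),
      ← covMat_eq_crossCov, ← covMat_eq_crossCov, covMat_mulVec (hεL t), hηε, hεη,
      (hmodel.obs_noise t).covMat_eq, (hmodel.state_noise t).covMat_eq]
    simp
  have hW : Tendsto (fun t => covMat μ (N t)) atTop
      (𝓝 (Sη + T * kalmanK Z R S * Sε * (T * kalmanK Z R S)ᵀ)) := by
    have hc : Continuous fun M : Matrix n m ℝ => Sη + M * Sε * Mᵀ := by fun_prop
    exact ((hc.tendsto _).comp hG).congr fun t => (hNcov t).symm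
  simp only [hv]
  refine ⟨fun t => ((hxL t).mulVec Z).add (hεL t), ?_, ?_⟩
  · have hmean : ∀ t, meanVec μ (N t) = 0 := fun t => by
      rw [hNdef, meanVec_sub (hηL t) ((hεL t).mulVec (G t)), meanVec_mulVec (hεL t),
        (hmodel.obs_noise t).meanVec_eq, (hmodel.state_noise t).meanVec_eq]
      simp
    have hc : Continuous fun z : n → ℝ => Z *ᵥ z := by fun_prop
    have h1 := (hc.tendsto 0).comp (tendsto_meanVec_zero_of_recursion hA hpow hx hx0 hN hmean)
    rw [mulVec_zero] at h1
    refine h1.congr fun t => ?_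
    rw [meanVec_add ((hxL t).mulVec Z) (hεL t), meanVec_mulVec (hxL t),
      (hmodel.obs_noise t).meanVec_eq, add_zero]
    rfl
  · obtain ⟨V, hV⟩ := exists_tendsto_covMat_of_recursion hA hpow hx hx0 hN hW hxN
    have hc : Continuous fun p : Matrix n n ℝ × Matrix n m ℝ =>
        Z * p.1 * Zᵀ + Z * p.2 + (Z * p.2)ᵀ + Sε := by fun_prop
    refine ⟨_, ((hc.tendsto (V, 0)).comp (hV.prodMk_nhds hxε)).congr fun t => ?_⟩
    rw [covMat_add ((hxL t).mulVec Z) (hεL t), covMat_mulVec (hxL t),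
      crossCov_mulVec_left (hxL t) (hεL t), (hmodel.obs_noise t).covMat_eq]
    rfl

end ForecastError

theorem theorem1 {Ω : Type*} [MeasurableSpace Ω] (μ : Measure Ω) [IsProbabilityMeasure μ]
    (d : ℕ) (p : Fin d → ℕ)
    (Zc : ∀ j, Matrix (Fin 1) (Fin (p j)) ℝ) (Tc : ∀ j, Matrix (Fin (p j)) (Fin (p j)) ℝ)
    (Sε : Matrix (Fin d) (Fin d) ℝ) (Sη : Matrix (StateIdx p) (StateIdx p) ℝ)
    (a₁ : StateIdx p → ℝ) (P₁ : Matrix (StateIdx p) (StateIdx p) ℝ)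
    (y : ℕ → Ω → Fin d → ℝ) (α : ℕ → Ω → StateIdx p → ℝ)
    (ε : ℕ → Ω → Fin d → ℝ) (η : ℕ → Ω → StateIdx p → ℝ)
    (hmodel : IsStateSpaceModel μ (designMatrix Zc) (transitionMatrix Tc) Sε Sη a₁ P₁ y α ε η)
    (a₁' : StateIdx p → ℝ) (P₁' : ∀ j, Matrix (Fin (p j)) (Fin (p j)) ℝ)
    (hP₁' : ∀ j, (P₁' j).PosSemidef)
    (hassump : FilterAssumption Zc Tc Sε Sη P₁') :
    (∀ t i, MemLp (fun ω => misspecError Zc Tc Sε Sη a₁' P₁' y t ω i) 2 μ) ∧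
    Tendsto (fun t => meanVec μ (misspecError Zc Tc Sε Sη a₁' P₁' y t)) atTop (𝓝 0) ∧
    ∃ V : Matrix (Fin d) (Fin d) ℝ,
      Tendsto (fun t => covMat μ (misspecError Zc Tc Sε Sη a₁' P₁' y t)) atTop (𝓝 V) :=
  hmodel.tendsto_moments_kalmanV hassump.obsCov'_pos hassump.observable hassump.controllable'
    (PosSemidef.blockDiagonal' hP₁') a₁'
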